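/- Let $p$ be a prime with $p\equiv 2 \pmod 3$, let $k$ be a field of characteristic $p$ containing a primitive cube root of unity $\zeta_3$ (for instance an algebraically closed field), and let $n\ge 2$. Let $E_3$ be the (supersingular) elliptic curve $y^2+y=x^3$ over $k$, i.e. the plane projective cubic $Y^2Z+YZ^2=X^3$, with the automorphism $\tau_3\colon (x,y)\mapsto(\zeta_3x,y)$, and let $G_2\simeq(\mathbb{Z}/3\mathbb{Z})^{n-1}$ be the group of automorphisms of $E_3^n$ generated by $$(\tau_3,1,\dots,1,\tau_3^2),\ (1,\tau_3,1,\dots,1,\tau_3^2),\ \dots,\ (1,\dots,1,\tau_3,\tau_3^2).$$ Let $X\to E_3^n/G_2$ be a resolution of singularities (a proper birational morphism from a smooth variety over $k$); for instance, $X$ may be the Calabi--Yau manifold $X_{3,n}$, a crepant resolution of $E_3^n/G_2$. Then $X$ is a Zariski variety: $X$ has dimension $n$, and there is a dominant rational map $\mathbb{P}^n_k\dashrightarrow X$ over $k$ which is purely inseparable of degree $p$, i.e. such that the extension of function fields $k(\mathbb{P}^n)/k(X)$ is purely inseparable of degree $p$. -/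

import Mathlib

universe u

noncomputable section

namespace ZariskiKummer

open AlgebraicGeometry CategoryTheory CategoryTheory.Limits MvPolynomial
open scoped DirectSum

section QuotientGrading
variable {k A : Type u} [Field k] [CommRing A] [Algebra k A]

/-- The grading induced on a quotient `A ⧸ I` of a graded algebra. -/
def quotientGrading (𝒜 : ℕ → Submodule k A) (I : Ideal A) (d : ℕ) : Submodule k (A ⧸ I) :=
  (𝒜 d).map (Ideal.Quotient.mkₐ k I).toLinearMap

variable (𝒜 : ℕ → Submodule k A) [GradedAlgebra 𝒜] (I : Ideal A)

instance quotientGrading_gradedMonoid : SetLike.GradedMonoid (quotientGrading 𝒜 I) where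
  one_mem := ⟨1, SetLike.GradedOne.one_mem, map_one (Ideal.Quotient.mkₐ k I)⟩
  mul_mem := by
    rintro i j _ _ ⟨a, ha, rfl⟩ ⟨b, hb, rfl⟩
    exact ⟨a * b, SetLike.GradedMul.mul_mem ha hb, map_mul (Ideal.Quotient.mkₐ k I) a b⟩

/-- The degree `d` part of `A → A ⧸ I`. -/
def quotientGradingMk (d : ℕ) : 𝒜 d →ₗ[k] quotientGrading 𝒜 I d :=
  (Ideal.Quotient.mkₐ k I).toLinearMap.restrict fun x hx => ⟨x, hx, rfl⟩

/-- The decomposition map of `A`, followed by reduction modulo `I`. -/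
def toQuotientDirectSum : A →ₐ[k] ⨁ d, quotientGrading 𝒜 I d :=
  (DirectSum.toAlgebra k (fun d => 𝒜 d)
    (fun d => (DirectSum.lof k ℕ (fun d => quotientGrading 𝒜 I d) d).comp
      (quotientGradingMk 𝒜 I d)) rfl
    (fun {i j} a b => by
      simp only [LinearMap.comp_apply, DirectSum.lof_eq_of, DirectSum.of_mul_of]
      rfl)).comp (DirectSum.decomposeAlgEquiv 𝒜 : A →ₐ[k] ⨁ d, 𝒜 d)

lemma toQuotientDirectSum_of_mem {d : ℕ} {a : A} (ha : a ∈ 𝒜 d) :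
    toQuotientDirectSum 𝒜 I a =
      DirectSum.of (fun d => quotientGrading 𝒜 I d) d (quotientGradingMk 𝒜 I d ⟨a, ha⟩) := by
  simp only [toQuotientDirectSum, AlgHom.comp_apply, AlgEquiv.coe_toAlgHom,
    DirectSum.decomposeAlgEquiv_apply]
  rw [DirectSum.decompose_of_mem 𝒜 ha]
  erw [DirectSum.toAddMonoid_of]
  rfl

lemma toQuotientDirectSum_eq_zero (hI : I.IsHomogeneous 𝒜) {a : A} (ha : a ∈ I) :
    toQuotientDirectSum 𝒜 I a = 0 := by
  classical
  rw [← DirectSum.sum_support_decompose 𝒜 a, map_sum]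
  refine Finset.sum_eq_zero fun i _ => ?_
  rw [toQuotientDirectSum_of_mem 𝒜 I (SetLike.coe_mem _)]
  have : quotientGradingMk 𝒜 I i ⟨(DirectSum.decompose 𝒜 a i : A), SetLike.coe_mem _⟩ = 0 :=
    Subtype.ext (Ideal.Quotient.eq_zero_iff_mem.mpr (hI i ha))
  rw [this, map_zero]

/-- A quotient of a graded algebra by a homogeneous ideal is graded. -/
@[reducible]
def quotientGradedAlgebra (hI : I.IsHomogeneous 𝒜) : GradedAlgebra (quotientGrading 𝒜 I) :=
  GradedAlgebra.ofAlgHom _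
    (Ideal.Quotient.liftₐ I (toQuotientDirectSum 𝒜 I)
      fun _ ha => toQuotientDirectSum_eq_zero 𝒜 I hI ha)
    (by
      refine Ideal.Quotient.algHom_ext k (AlgHom.ext fun a => ?_)
      induction a using DirectSum.Decomposition.inductionOn 𝒜 with
      | zero => simp
      | @homogeneous i m =>
        change DirectSum.coeAlgHom _ (toQuotientDirectSum 𝒜 I m) = _
        rw [toQuotientDirectSum_of_mem 𝒜 I m.2, DirectSum.coeAlgHom_of]
        rfl
      | add m m' h h' => rw [map_add, map_add, h, h'])
    (by
      rintro i ⟨_, a, ha, rfl⟩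
      exact toQuotientDirectSum_of_mem 𝒜 I ha)

end QuotientGrading

section Proj
variable {k A B : Type u} [Field k] [CommRing A] [Algebra k A] [CommRing B] [Algebra k B]

/-- `Proj` of a graded `k`-algebra, as a `k`-scheme. -/
def projOver (𝒜 : ℕ → Submodule k A) [GradedAlgebra 𝒜] : Over (Spec (.of k)) :=
  Over.mk (Proj.toSpecZero 𝒜 ≫ Spec.map (CommRingCat.ofHom (algebraMap k (𝒜 0))))

variable {𝒜 : ℕ → Submodule k A} [GradedAlgebra 𝒜] {ℬ : ℕ → Submodule k B} [GradedAlgebra ℬ]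

lemma irrelevant_le_map (f : 𝒜 →+*ᵍ ℬ) (hf : ∀ d, ∀ b ∈ ℬ d, ∃ a ∈ 𝒜 d, f a = b) :
    HomogeneousIdeal.irrelevant ℬ ≤ (HomogeneousIdeal.irrelevant 𝒜).map f := by
  refine (HomogeneousIdeal.irrelevant_le ℬ).mpr ?_
  intro i hi b hb
  obtain ⟨a, ha, rfl⟩ := hf i b hb
  exact Ideal.mem_map_of_mem _ (HomogeneousIdeal.mem_irrelevant_of_mem 𝒜 hi ha)

lemma awayι_projMap (f : 𝒜 →+*ᵍ ℬ)
    (hf : HomogeneousIdeal.irrelevant ℬ ≤ (HomogeneousIdeal.irrelevant 𝒜).map f)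
    (hk : ∀ c : k, f (algebraMap k A c) = algebraMap k B c) {i : ℕ} (hi : 0 < i) {a : A}
    (ha : a ∈ 𝒜 i) :
    Proj.awayι ℬ (f a) (f.2 ha) hi ≫ Proj.map f hf ≫ (projOver 𝒜).hom =
      Proj.awayι ℬ (f a) (f.2 ha) hi ≫ (projOver ℬ).hom := by
  simp only [projOver, Over.mk_hom]
  rw [Proj.awayι_comp_map_assoc f hf hi a ha, Proj.awayι_toSpecZero_assoc,
    Proj.awayι_toSpecZero_assoc, ← Spec.map_comp, ← Spec.map_comp, ← Spec.map_comp]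
  congr 1
  ext c
  change Localization.mk (f (algebraMap k A c)) (⟨f 1, _⟩ : Submonoid.powers (f a)) =
    Localization.mk (algebraMap k B c) 1
  rw [hk c]
  congr 1
  exact Subtype.ext (map_one f)

/-- The morphism of `k`-schemes `Proj ℬ ⟶ Proj 𝒜` induced by a surjective graded homomorphism
`𝒜 → ℬ` of `k`-algebras. -/
def projOverMap (f : 𝒜 →+*ᵍ ℬ) (hf : ∀ d, ∀ b ∈ ℬ d, ∃ a ∈ 𝒜 d, f a = b)
    (hk : ∀ c : k, f (algebraMap k A c) = algebraMap k B c) : projOver ℬ ⟶ projOver 𝒜 :=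
  Over.homMk (Proj.map f (irrelevant_le_map f hf)) (by
    refine (Proj.mapAffineOpenCover f (irrelevant_le_map f hf)).openCover.hom_ext _ _ fun s => ?_
    exact awayι_projMap f _ hk s.1.2 s.2.2)

end Proj

section Curve
variable (k : Type u) [Field k]

attribute [local instance] MvPolynomial.gradedAlgebra

/-- The homogeneous equation `Y²Z + YZ² - X³` of the plane cubic `y² + y = x³`. -/
def cubic : MvPolynomial (Fin 3) k := X 1 ^ 2 * X 2 + X 1 * X 2 ^ 2 - X 0 ^ 3

lemma cubic_isHomogeneous : (cubic k).IsHomogeneous 3 :=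
  ((((isHomogeneous_X k 1).pow 2).mul (isHomogeneous_X k 2)).add
    ((isHomogeneous_X k 1).mul ((isHomogeneous_X k 2).pow 2))).sub ((isHomogeneous_X k 0).pow 3)

/-- The grading of the homogeneous coordinate ring `k[X, Y, Z] ⧸ (Y²Z + YZ² - X³)`. -/
abbrev coordGrading : ℕ → Submodule k (MvPolynomial (Fin 3) k ⧸ Ideal.span {cubic k}) :=
  quotientGrading (homogeneousSubmodule (Fin 3) k) (Ideal.span {cubic k})

instance coordGrading_gradedAlgebra : GradedAlgebra (coordGrading k) :=
  quotientGradedAlgebra _ _ (Ideal.homogeneous_span _ _ (by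
    rintro _ rfl
    exact ⟨3, cubic_isHomogeneous k⟩))

/-- The elliptic curve `E₃ : y² + y = x³` over `k`. -/
def E3 : Over (Spec (.of k)) := projOver (coordGrading k)

variable {k}

/-- The substitution `X ↦ uX`, `Y ↦ Y`, `Z ↦ Z`. -/
def scalePoly (u : k) : MvPolynomial (Fin 3) k →ₐ[k] MvPolynomial (Fin 3) k :=
  aeval ![C u * X 0, X 1, X 2]

lemma scalePoly_mem (u : k) {d : ℕ} {f : MvPolynomial (Fin 3) k} (hf : f.IsHomogeneous d) :
    (scalePoly u f).IsHomogeneous d := by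
  have := hf.aeval (n := 1) (![C u * X 0, X 1, X 2] : Fin 3 → MvPolynomial (Fin 3) k) (fun i => by
    fin_cases i
    · exact (isHomogeneous_C (Fin 3) u).mul (isHomogeneous_X k 0)
    · exact isHomogeneous_X k 1
    · exact isHomogeneous_X k 2)
  rwa [one_mul] at this

lemma scalePoly_cubic {u : k} (hu : u ^ 3 = 1) : scalePoly u (cubic k) = cubic k := by
  simp [scalePoly, cubic, mul_pow, ← C_pow, hu]

lemma scalePoly_comp (u v : k) : (scalePoly u).comp (scalePoly v) = scalePoly (u * v) := by
  ext i : 1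
  fin_cases i
  · simp [scalePoly]; ring
  · simp [scalePoly]
  · simp [scalePoly]

lemma scalePoly_one : scalePoly (1 : k) = AlgHom.id k _ := by
  ext i : 1
  fin_cases i <;> simp [scalePoly]

/-- The graded automorphism of the coordinate ring induced by `X ↦ uX`, where `u³ = 1`. -/
def scaleHom (u : k) (hu : u ^ 3 = 1) : coordGrading k →+*ᵍ coordGrading k where
  toRingHom := Ideal.quotientMap (Ideal.span {cubic k}) (scalePoly u : MvPolynomial (Fin 3) k →+* _) (by
    rw [Ideal.span_le, Set.singleton_subset_iff]
    change scalePoly u (cubic k) ∈ Ideal.span {cubic k}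
    rw [scalePoly_cubic hu]
    exact Ideal.mem_span_singleton_self _)
  map_mem := by
    rintro d _ ⟨f, hf, rfl⟩
    exact ⟨scalePoly u f, scalePoly_mem u hf, rfl⟩

lemma scaleHom_mk (u : k) (hu : u ^ 3 = 1) (f : MvPolynomial (Fin 3) k) :
    scaleHom u hu (Ideal.Quotient.mk _ f) = Ideal.Quotient.mk _ (scalePoly u f) := rfl

/-- The endomorphism `(x, y) ↦ (ux, y)` of `E₃`, where `u³ = 1`. -/
def scale (u : k) (hu : u ^ 3 = 1) : E3 k ⟶ E3 k :=
  projOverMap (scaleHom u hu)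
    (by
      rintro d _ ⟨f, hf, rfl⟩
      refine ⟨Ideal.Quotient.mk _ (scalePoly (u ^ 2) f), ⟨_, scalePoly_mem _ hf, rfl⟩, ?_⟩
      rw [scaleHom_mk, ← AlgHom.comp_apply, scalePoly_comp, ← pow_succ', hu, scalePoly_one]
      rfl)
    (fun c => by
      change scaleHom u hu (Ideal.Quotient.mk _ (C c)) = Ideal.Quotient.mk _ (C c)
      rw [scaleHom_mk]
      simp [scalePoly])

lemma scale_comp (u v : k) (hu : u ^ 3 = 1) (hv : v ^ 3 = 1) (h : u * v = 1) :
    scale u hu ≫ scale v hv = 𝟙 _ := by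
  ext : 1
  change Proj.map _ _ ≫ Proj.map _ _ = _
  rw [← Proj.map_comp]
  have : (scaleHom u hu).comp (scaleHom v hv) = .id (coordGrading k) := by
    apply GradedRingHom.ext
    intro x
    obtain ⟨f, rfl⟩ := Ideal.Quotient.mk_surjective x
    change Ideal.Quotient.mk _ (scalePoly u (scalePoly v f)) = _
    rw [← AlgHom.comp_apply, scalePoly_comp, h, scalePoly_one]
    rfl
  simp only [this]
  exact Proj.map_id

/-- The automorphism `τ : (x, y) ↦ (ζx, y)` of `E₃`, for a cube root of unity `ζ`. -/
def tau (ζ : k) (hζ : ζ ^ 3 = 1) : Aut (E3 k) where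
  hom := scale ζ hζ
  inv := scale (ζ ^ 2) (by rw [← pow_mul, mul_comm, pow_mul, hζ, one_pow])
  hom_inv_id := scale_comp _ _ _ _ (by rw [← pow_succ', hζ])
  inv_hom_id := scale_comp _ _ _ _ (by rw [← pow_succ, hζ])

end Curve

section Quotient

/-- The `n`-fold self-product of `E₃` over `k`. -/
def E3Pow (k : Type u) [Field k] (n : ℕ) : Over (Spec (.of k)) := ∏ᶜ fun _ : Fin n => E3 k

/-- The automorphism of the `n`-fold product acting by `g m` on the `m`-th factor. -/
def powAut {k : Type u} [Field k] {n : ℕ} (g : Fin n → Aut (E3 k)) : Aut (E3Pow k n) :=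
  Pi.mapIso g

/-- The group `Gᵢ` of automorphisms of `E₃ⁿ` generated by the `n - 1` automorphisms
`(1, …, 1, τ, 1, …, 1, τⁱ)`, with `τ` in some position other than the last one. -/
def groupG {k : Type u} [Field k] (ζ : k) (hζ : ζ ^ 3 = 1) (n i : ℕ) :
    Subgroup (Aut (E3Pow k n)) :=
  Subgroup.closure {g | ∃ j l : Fin n, (l : ℕ) + 1 = n ∧ j ≠ l ∧
    g = powAut fun m => if m = j then tau ζ hζ else if m = l then tau ζ hζ ^ i else 1}

variable {S : Scheme.{u}} {A X Y : Over S}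

lemma le_preimage_preimage {f : A ⟶ A} {q : A ⟶ Y} (h : f ≫ q = q) (U : Y.left.Opens) :
    q.left ⁻¹ᵁ U ≤ f.left ⁻¹ᵁ q.left ⁻¹ᵁ U := by
  rw [← Scheme.Hom.comp_preimage, ← Over.comp_left, h]

/-- `q : A ⟶ Y` is the quotient of `A` by the group `G` of automorphisms of `A` over `S`: it is
`G`-invariant, `Y` carries the quotient topology, the fibres of `q` are the `G`-orbits, and the
functions on `Y` are the `G`-invariant functions on `A`. -/
structure IsQuotient (G : Subgroup (Aut A)) (q : A ⟶ Y) : Prop where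
  invariant : ∀ g ∈ G, g.hom ≫ q = q
  isQuotientMap : Topology.IsQuotientMap q.left
  exists_of_eq : ∀ x y : A.left, q.left x = q.left y → ∃ g ∈ G, g.hom.left x = y
  app_injective : ∀ U : Y.left.Opens, Function.Injective (q.left.app U)
  exists_app_eq : ∀ (U : Y.left.Opens) (s : Γ(A.left, q.left ⁻¹ᵁ U)),
    (∀ (g : Aut A) (hg : g ∈ G), g.hom.left.appLE (q.left ⁻¹ᵁ U) (q.left ⁻¹ᵁ U)
      (le_preimage_preimage (invariant g hg) U) s = s) → ∃ t, q.left.app U t = s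

end Quotient

section Varieties
variable {k : Type u} [Field k]

/-- A variety over `k`: an integral separated scheme of finite type over `k`. -/
structure IsVariety (X : Over (Spec (.of k))) : Prop where
  isIntegral : IsIntegral X.left
  isSeparated : IsSeparated X.hom
  locallyOfFiniteType : LocallyOfFiniteType X.hom
  quasiCompact : QuasiCompact X.hom

/-- A resolution of singularities: a proper birational morphism `π : X ⟶ Y` from a smooth variety. -/
structure IsResolution {X Y : Over (Spec (.of k))} (π : X ⟶ Y) : Prop where
  isVariety : IsVariety X
  smooth : Smooth X.hom
  isProper : IsProper π.left
  birational : ∃ V : Y.left.Opens, Dense (V : Set Y.left) ∧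
    Dense (π.left ⁻¹ᵁ V : Set X.left) ∧ IsIso (π.left ∣_ V)

/-- The map `k → k(X)` into the function field of an integral `k`-scheme. -/
def toFunctionField (X : Over (Spec (.of k))) [IsIntegral X.left] : k →+* X.left.functionField :=
  ((Scheme.ΓSpecIso (.of k)).inv ≫ X.hom.appTop ≫
    X.left.presheaf.germ ⊤ (genericPoint X.left) trivial).hom

/-- The dimension of a variety: the transcendence degree of its function field. -/
def varietyDim (X : Over (Spec (.of k))) [IsIntegral X.left] : Cardinal :=
  letI := (toFunctionField X).toAlgebra
  Algebra.trdeg k X.left.functionField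

end Varieties

section RationalMaps

lemma specializes_genericPoint {X Y : Scheme.{u}} [IrreducibleSpace X] [IrreducibleSpace Y]
    (f : X ⟶ Y) [IsDominant f] : f (genericPoint X) ⤳ genericPoint Y := by
  have h : IsGenericPoint (f (genericPoint X)) ⊤ := by
    have := (genericPoint_spec X).image f.continuous
    rwa [Set.image_univ, f.denseRange.closure_range] at this
  exact (isGenericPoint_iff_specializes.mp h _).mpr trivial

/-- The extension of function fields `k(Y) → k(X)` induced by a dominant morphism. -/
def functionFieldMap {X Y : Scheme.{u}} [IrreducibleSpace X] [IrreducibleSpace Y]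
    (f : X ⟶ Y) [IsDominant f] : Y.functionField ⟶ X.functionField :=
  Y.presheaf.stalkSpecializes (specializes_genericPoint f) ≫ f.stalkMap (genericPoint X)

/-- A dominant morphism of integral schemes is purely inseparable of degree `d` (generically) if
the induced extension of function fields is so. -/
def IsPurelyInseparableOfDegree {X Y : Scheme.{u}} [IrreducibleSpace X] [IrreducibleSpace Y]
    (f : X ⟶ Y) [IsDominant f] (d : ℕ) : Prop :=
  letI := (functionFieldMap f).hom.toAlgebra
  IsPurelyInseparable Y.functionField X.functionField ∧
    Module.finrank Y.functionField X.functionField = d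

instance irreducibleSpace_domain {X Y : Scheme.{u}} [IrreducibleSpace X] (f : X.PartialMap Y) :
    IrreducibleSpace f.domain := by
  have : Nonempty f.domain := f.dense_domain.nonempty.to_subtype
  have : PreirreducibleSpace f.domain :=
    Subtype.preirreducibleSpace (PreirreducibleSpace.isPreirreducible_univ.open_subset
      f.domain.2 (Set.subset_univ _))
  exact ⟨inferInstance⟩

/-- A dominant rational map is purely inseparable of degree `d` if a representative (equivalently,
every representative) is so. -/
def RationalMapIsPurelyInseparableOfDegree {X Y : Scheme.{u}} [IrreducibleSpace X]
    [IrreducibleSpace Y] (f : X ⤏ Y) (d : ℕ) : Prop :=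
  ∃ (g : X.PartialMap Y) (_ : IsDominant g.hom), g.toRationalMap = f ∧
    IsPurelyInseparableOfDegree g.hom d

end RationalMaps

section ProjectiveSpace
attribute [local instance] MvPolynomial.gradedAlgebra

/-- Projective `n`-space over `k`. -/
def projectiveSpace (k : Type u) [Field k] (n : ℕ) : Over (Spec (.of k)) :=
  projOver (homogeneousSubmodule (Fin (n + 1)) k)

instance irreducibleSpace_projectiveSpace (k : Type u) [Field k] (n : ℕ) :
    IrreducibleSpace (projectiveSpace k n).left := by
  let η : Proj (homogeneousSubmodule (Fin (n + 1)) k) :=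
    { asHomogeneousIdeal := ⊥
      isPrime := by
        rw [HomogeneousIdeal.toIdeal_bot]
        exact Ideal.isPrime_bot
      not_irrelevant_le := fun h => by
        have h0 : (X 0 : MvPolynomial (Fin (n + 1)) k) ∈
            HomogeneousIdeal.irrelevant (homogeneousSubmodule (Fin (n + 1)) k) :=
          HomogeneousIdeal.mem_irrelevant_of_mem _ one_pos (isHomogeneous_X k 0)
        exact X_ne_zero (R := k) (0 : Fin (n + 1)) (h h0) }
  have h : closure {η} = (Set.univ : Set (Proj (homogeneousSubmodule (Fin (n + 1)) k))) := by
    refine Set.eq_univ_of_forall fun x => (ProjectiveSpectrum.le_iff_mem_closure _ η x).mp ?_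
    exact (ProjectiveSpectrum.as_ideal_le_as_ideal _ η x).mp bot_le
  have : IsIrreducible (Set.univ : Set (Proj (homogeneousSubmodule (Fin (n + 1)) k))) := by
    rw [← h]
    exact isIrreducible_singleton.closure
  exact (irreducibleSpace_def _).mpr this

end ProjectiveSpace

/-- A variety `X` over `k` is a Zariski variety of dimension `n` in characteristic `p` if there is
a dominant purely inseparable rational map `ℙⁿ ⇢ X` over `k` of degree `p`. -/
def IsZariskiVariety {k : Type u} [Field k] (p n : ℕ) (X : Over (Spec (.of k))) : Prop :=
  IsVariety X ∧ ∃ _ : IsIntegral X.left, varietyDim X = n ∧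
    ∃ f : (projectiveSpace k n).left ⤏ X.left,
      f.compHom X.hom = (projectiveSpace k n).hom.toRationalMap ∧
      f.IsDominant ∧ RationalMapIsPurelyInseparableOfDegree f p

end ZariskiKummer

end

open AlgebraicGeometry CategoryTheory ZariskiKummer

noncomputable section

namespace ZariskiKummer

open AlgebraicGeometry CategoryTheory CategoryTheory.Limits MvPolynomial

set_option linter.style.haveILetI false

/-! On the affine chart with equations `y i ^ 2 + y i = x i ^ 3`, the group multiplies the `x i` by
cube roots of unity whose product is 1. By a Kummer argument (`mem_adjoin_of_forall_map_eq`) the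
invariant field is generated over `k` by the `y i` and `w = ∏ x i`, where `w ^ 3 = ∏ (y i ^ 2 + y
i)`. A resolution is birational to the quotient, so this is `k(X)`.

Adjoin `s` with `s ^ p = y 0`. Frobenius is additive, so `y 0 ^ 2 + y 0 = (s * (s + 1)) ^ p`. Write
`p = 3 * e + 2`; then `t = w / (s * (s + 1)) ^ (e + 1)` satisfies `t ^ 3 * (s * (s + 1)) = (y 1 ^ 2
+ y 1) * c`, with `c` the product over the remaining indices. Over the field generated by `t` and
the remaining `y i` this is a conic in `(s, y 1)` through the origin, and the slope `y 1 / s`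
parametrizes it (`conic_parametrization`). The enlarged field is therefore purely transcendental,
generated by the slope, `t` and the remaining `y i`. It has degree exactly `p` over `k(X)` because
`y 0` is not a `p`-th power there (`exists_rational_purelyInseparable`).

On the scheme side, the affine chart is an open subscheme of the product
(`IsAffinePower.isOpenImmersion_chart`) and is stable under the group, so it is the preimage of an
open set of the quotient. Its generic point maps to the quotient and lifts to the generic point of
`X`, which embeds `k(X)` in the fraction field of the chart
(`IsResolution.exists_functionField_hom`, `exists_functionField_hom_range`). Finally, an inclusion
of function fields over `k` spreads out to a dominant rational map
(`exists_rationalMap_of_functionField`). -/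

/-! ### Purely inseparable extensions and rational maps from function field inclusions. -/

/-- A ring extension, given as a ring homomorphism, is purely inseparable of degree `d`. -/
def RingHomIsPurelyInseparable {F L : Type*} [CommRing F] [CommRing L] (f : F →+* L) (d : ℕ) :
    Prop :=
  letI := f.toAlgebra
  IsPurelyInseparable F L ∧ Module.finrank F L = d

lemma RingHomIsPurelyInseparable.comp_equiv {F L L' : Type*} [CommRing F] [CommRing L]
    [CommRing L'] {f : F →+* L} {d : ℕ} (h : RingHomIsPurelyInseparable f d) (e : L ≃+* L') :
    RingHomIsPurelyInseparable ((e : L →+* L').comp f) d := by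
  letI := f.toAlgebra
  letI := ((e : L →+* L').comp f).toAlgebra
  let e' : L ≃ₐ[F] L' := AlgEquiv.ofRingEquiv (f := e) fun _ => rfl
  obtain ⟨h1, h2⟩ := h
  exact ⟨e'.isPurelyInseparable, by rw [← h2]; exact e'.toLinearEquiv.finrank_eq.symm⟩

lemma RingHomIsPurelyInseparable.equiv_comp_of_field {F F' L : Type*} [Field F] [Field F']
    [Field L] {f : F →+* L} {d : ℕ} (h : RingHomIsPurelyInseparable f d) (e : F' ≃+* F) :
    RingHomIsPurelyInseparable (f.comp (e : F' →+* F)) d := by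
  letI := f.toAlgebra
  letI := (f.comp (e : F' →+* F)).toAlgebra
  letI := (e : F' →+* F).toAlgebra
  haveI : IsScalarTower F' F L := .of_algebraMap_eq fun _ => rfl
  obtain ⟨h1, h2⟩ := h
  have hs : Function.Surjective (algebraMap F' F) := e.surjective
  haveI : IsPurelyInseparable F' F :=
    isPurelyInseparable_iff_pow_mem F' (ringExpChar F') |>.mpr fun x => ⟨0, by
      obtain ⟨y, rfl⟩ := hs x
      exact ⟨y, by simp⟩⟩
  refine ⟨IsPurelyInseparable.trans F' F L, ?_⟩
  have h3 : Module.finrank F' F = 1 :=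
    finrank_eq_one_iff_of_nonzero' (1 : F) one_ne_zero |>.mpr fun w => by
      obtain ⟨y, rfl⟩ := hs w
      exact ⟨y, by rw [Algebra.smul_def, mul_one]⟩
  rw [← Module.finrank_mul_finrank F' F L, h3, one_mul, h2]

/-- Only a ring structure is assumed on `F'`, as on a stalk in `CommRingCat`; the field structure is
transported along `e`. -/
lemma RingHomIsPurelyInseparable.equiv_comp {F F' L : Type*} [Field F] [CommRing F']
    [Field L] {f : F →+* L} {d : ℕ} (h : RingHomIsPurelyInseparable f d) (e : F' ≃+* F) :
    RingHomIsPurelyInseparable (f.comp (e : F' →+* F)) d := by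
  letI : Field F' := (e.toMulEquiv.isField (Field.toIsField F)).toField
  exact h.equiv_comp_of_field e

lemma fromSpecStalk_genericPoint_comp_hom {k : Type u} [Field k] (X : Over (Spec (.of k)))
    [IsIntegral X.left] :
    X.left.fromSpecStalk (genericPoint X.left) ≫ X.hom =
      Spec.map (CommRingCat.ofHom (toFunctionField X)) := by
  rw [toFunctionField, CommRingCat.ofHom_hom, Spec.map_comp, Spec.map_comp,
    ← Scheme.fromSpecStalk_toSpecΓ, Category.assoc, Category.assoc,
    ← Scheme.toSpecΓ_naturality_assoc, ← SpecMap_ΓSpecIso_hom, ← Spec.map_comp, Iso.inv_hom_id,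
    Spec.map_id, Category.comp_id]

/-- Since `fromSpecStalk` is a monomorphism, this square determines `functionFieldMap f`. -/
lemma SpecMap_functionFieldMap {X Y : Scheme.{u}} [IrreducibleSpace X] [IrreducibleSpace Y]
    (f : X ⟶ Y) [IsDominant f] :
    Spec.map (functionFieldMap f) ≫ Y.fromSpecStalk (genericPoint Y) =
      X.fromSpecStalk (genericPoint X) ≫ f := by
  rw [functionFieldMap, Spec.map_comp, Category.assoc,
    Scheme.SpecMap_stalkSpecializes_fromSpecStalk, Scheme.SpecMap_stalkMap_fromSpecStalk]

/-- A morphism over `k` from the generic point of `P` to a scheme locally of finite type extends to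
an open neighbourhood. It is dominant because it meets the generic point of `X`, and its function
field map is `ψ` up to the isomorphism between the function fields of `P` and of the domain. -/
lemma exists_rationalMap_of_functionField {k : Type u} [Field k] {P X : Over (Spec (.of k))}
    [IsIntegral P.left] [IsIntegral X.left] [LocallyOfFiniteType X.hom]
    (ψ : X.left.functionField ⟶ P.left.functionField)
    (hψ : CommRingCat.ofHom (toFunctionField X) ≫ ψ = CommRingCat.ofHom (toFunctionField P)) (d : ℕ)
    (hd : RingHomIsPurelyInseparable ψ.hom d) :
    ∃ f : P.left ⤏ X.left, f.compHom X.hom = P.hom.toRationalMap ∧ f.IsDominant ∧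
      RationalMapIsPurelyInseparableOfDegree f d := by
  let m : Spec P.left.functionField ⟶ X.left :=
    Spec.map (ψ) ≫ X.left.fromSpecStalk (genericPoint X.left)
  have hm : m ≫ X.hom = P.left.fromSpecStalk _ ≫ P.hom := by
    rw [Category.assoc, fromSpecStalk_genericPoint_comp_hom, fromSpecStalk_genericPoint_comp_hom,
      ← Spec.map_comp, hψ]
  let g := Scheme.PartialMap.ofFromSpecStalk P.hom X.hom m hm
  have hgm : g.fromFunctionField = m :=
    Scheme.PartialMap.fromSpecStalkOfMem_ofFromSpecStalk P.hom X.hom m hm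
  have hmem : genericPoint P.left ∈ g.domain :=
    Scheme.PartialMap.mem_domain_ofFromSpecStalk P.hom X.hom m hm
  have hgen : g.domain.ι (genericPoint g.domain) = genericPoint P.left :=
    genericPoint_eq_of_isOpenImmersion g.domain.ι
  have hfac : g.domain.toScheme.fromSpecStalk (genericPoint g.domain) ≫ g.hom =
      Spec.map (P.left.presheaf.stalkSpecializes (specializes_of_eq hgen) ≫
        g.domain.ι.stalkMap (genericPoint g.domain)) ≫ m := by
    rw [← hgm]
    have h1 : g.domain.toScheme.fromSpecStalk (genericPoint g.domain) =
      Spec.map (P.left.presheaf.stalkSpecializes (specializes_of_eq hgen) ≫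
        g.domain.ι.stalkMap (genericPoint g.domain)) ≫ g.domain.fromSpecStalkOfMem _ hmem := by
      rw [← cancel_mono g.domain.ι, Category.assoc, Scheme.Opens.fromSpecStalkOfMem_ι, Spec.map_comp,
        Category.assoc, Scheme.SpecMap_stalkSpecializes_fromSpecStalk,
        Scheme.SpecMap_stalkMap_fromSpecStalk]
    rw [h1]
    rfl
  have hdom : IsDominant g.hom := by
    have h1 : g.hom (g.domain.toScheme.fromSpecStalk (genericPoint g.domain)
        (IsLocalRing.closedPoint _)) = X.left.fromSpecStalk (genericPoint X.left) _ :=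
      congr($hfac (IsLocalRing.closedPoint _))
    rw [Scheme.fromSpecStalk_closedPoint] at h1
    -- The range of `fromSpecStalk` at a point is the set of its generizations.
    have h2 : g.hom (genericPoint g.domain) ⤳ genericPoint X.left := by
      have : g.hom (genericPoint g.domain) ∈
          Set.range (X.left.fromSpecStalk (genericPoint X.left)) := ⟨_, h1.symm⟩
      rwa [Scheme.range_fromSpecStalk] at this
    refine ⟨fun x => ?_⟩
    exact closure_mono (Set.singleton_subset_iff.mpr (Set.mem_range_self (genericPoint g.domain)))
      (specializes_iff_mem_closure.mp (h2.trans (genericPoint_specializes x)))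
  refine ⟨g.toRationalMap, ((Scheme.RationalMap.equivFunctionField P.hom X.hom) ⟨m, hm⟩).2,
    inferInstance, g, hdom, rfl, ?_⟩
  have key : functionFieldMap g.hom = ψ ≫
      P.left.presheaf.stalkSpecializes (specializes_of_eq hgen) ≫
        g.domain.ι.stalkMap (genericPoint g.domain) := by
    apply Spec.map_injective
    rw [← cancel_mono (X.left.fromSpecStalk (genericPoint X.left)), SpecMap_functionFieldMap, hfac,
      Spec.map_comp ψ, Category.assoc]
  have hiso : IsIso (P.left.presheaf.stalkSpecializes (specializes_of_eq hgen) ≫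
        g.domain.ι.stalkMap (genericPoint g.domain)) := by
    have : IsIso (P.left.presheaf.stalkSpecializes (specializes_of_eq hgen)) :=
      (P.left.presheaf.stalkCongr (.of_eq hgen.symm)).isIso_hom
    infer_instance
  have := hd.comp_equiv (asIso (P.left.presheaf.stalkSpecializes (specializes_of_eq hgen) ≫
        g.domain.ι.stalkMap (genericPoint g.domain))).commRingCatIsoToRingEquiv
  change RingHomIsPurelyInseparable (functionFieldMap g.hom).hom d
  rw [key]
  exact this

/-! ### Field theory of the inseparable cover. -/

open IntermediateField in
lemma isAlgebraic_of_mem_field_adjoin {k Ω : Type*} [Field k] [Field Ω] [Algebra k Ω] {s : Set Ω}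
    {a : Ω} (ha : a ∈ IntermediateField.adjoin k s) : IsAlgebraic (Algebra.adjoin k s) a := by
  obtain ⟨r, hr, t, ht, rfl⟩ := IntermediateField.mem_adjoin_iff_div.mp ha
  rw [div_eq_mul_inv]
  exact (isAlgebraic_algebraMap (⟨r, hr⟩ : Algebra.adjoin k s)).mul
    (isAlgebraic_algebraMap (⟨t, ht⟩ : Algebra.adjoin k s)).inv

/-- A family over which the whole field is algebraic and which has no more elements than the finite
transcendence degree must be independent. -/
lemma isTranscendenceBasis_of_forall_isAlgebraic {ι k Ω : Type*} [Finite ι] [Field k] [Field Ω]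
    [Algebra k Ω] {y : ι → Ω} (hy : IsTranscendenceBasis k y) {v : ι → Ω}
    (h : ∀ i, IsAlgebraic (Algebra.adjoin k (Set.range v)) (y i)) : IsTranscendenceBasis k v := by
  have := hy.isAlgebraic_iff.mpr h
  exact Algebra.IsAlgebraic.isTranscendenceBasis_of_lift_le_trdeg_of_finite k v
    hy.lift_cardinalMk_eq_trdeg.le

/-- The polynomial ring is integrally closed, so such a root would be a polynomial; but a variable
is irreducible, hence not a proper power. -/
lemma not_exists_pow_eq_X {ι k : Type*} [Field k] {p : ℕ} (hp : p ≠ 1) (i : ι)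
    (r : FractionRing (MvPolynomial ι k)) (hr : r ^ p = algebraMap (MvPolynomial ι k) _ (X i)) :
    False := by
  have h0 : p ≠ 0 := by
    rintro rfl
    rw [pow_zero, ← map_one (algebraMap (MvPolynomial ι k) _)] at hr
    have := IsFractionRing.injective (MvPolynomial ι k) _ hr
    have h1 := congr(MvPolynomial.eval (0 : ι → k) $this)
    simp at h1
  have hr_int : IsIntegral (MvPolynomial ι k) r :=
    IsIntegral.of_pow (Nat.pos_of_ne_zero h0) (hr ▸ isIntegral_algebraMap)
  obtain ⟨f, rfl⟩ := IsIntegrallyClosed.isIntegral_iff.mp hr_int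
  rw [← map_pow] at hr
  have := IsFractionRing.injective (MvPolynomial ι k) _ hr
  exact not_irreducible_pow hp (this.symm ▸ (MvPolynomial.X_prime (R := k) (i := i)).irreducible)

section
open IntermediateField
variable {k Ω : Type*} [Field k] [Field Ω] [Algebra k Ω] {p : ℕ} [Fact p.Prime] [CharP k p]

/-- An element of a simple separable extension of `k(y)` whose `p`-th power lies in `k(y)` is
in `k(y)`. -/
lemma mem_of_pow_mem_of_isSeparable {E : IntermediateField k Ω} {w z : Ω}
    (hw : IsSeparable E w) (hz : z ∈ E⟮w⟯) (hzp : z ^ p ∈ E) : z ∈ E := by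
  have : ExpChar E p := by
    have : CharP E p := charP_of_injective_algebraMap (algebraMap k E).injective p
    exact ExpChar.prime Fact.out
  have h1 : Algebra.IsSeparable E E⟮w⟯ := (isSeparable_adjoin_simple_iff_isSeparable E Ω).mpr hw
  have h2 : IsSeparable E z := isSeparable_of_mem_isSeparable E Ω hz
  have h3 : Algebra.IsSeparable E E⟮z⟯ := (isSeparable_adjoin_simple_iff_isSeparable E Ω).mpr h2
  have h4 : IsPurelyInseparable E E⟮z⟯ :=
    (isPurelyInseparable_adjoin_simple_iff_pow_mem E Ω p).mpr ⟨1, ⟨z ^ p, hzp⟩, by simp⟩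
  have h5 := mem_adjoin_simple_self E z
  rw [E⟮z⟯.eq_bot_of_isPurelyInseparable_of_isSeparable, mem_bot] at h5
  obtain ⟨x, rfl⟩ := h5
  exact x.2

/-- `X ^ 3 - w ^ 3` is separable once 3 and `w` are nonzero. -/
lemma isSeparable_of_pow_three {E : IntermediateField k Ω} {w : Ω} (h3 : (3 : k) ≠ 0) (h0 : w ≠ 0)
    (hw : w ^ 3 ∈ E) : IsSeparable E w := by
  have hne : (⟨w ^ 3, hw⟩ : E) ≠ 0 := fun h => h0 (by simpa using congr_arg Subtype.val h)
  have hsep : (Polynomial.X ^ 3 - Polynomial.C (⟨w ^ 3, hw⟩ : E)).Separable := by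
    refine Polynomial.separable_X_pow_sub_C _ ?_ hne
    intro h
    apply h3
    apply (algebraMap k E).injective
    rw [map_ofNat, map_zero]
    exact_mod_cast h
  exact hsep.of_dvd (minpoly.dvd _ _ (by simp))

omit [CharP k p] in
lemma pow_ne_of_algebraicIndependent {ι : Type*} {y : ι → Ω} (hy : AlgebraicIndependent k y)
    {E : IntermediateField k Ω} (hE : E = adjoin k (Set.range y)) {z : Ω} (hz : z ∈ E) (i : ι)
    (h : z ^ p = y i) : False := by
  subst hE
  refine not_exists_pow_eq_X (Fact.out : p.Prime).ne_one i (hy.aevalEquivField.symm ⟨z, hz⟩) ?_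
  rw [← map_pow, AlgEquiv.symm_apply_eq]
  ext
  rw [hy.aevalEquivField_algebraMap_apply_coe, aeval_X]
  exact h


/-- The change of variables that makes the inseparable cover rational. -/
lemma conic_parametrization {s y w c : Ω} {p e : ℕ} (hp : p = 3 * e + 2) (hs : s ≠ 0)
    (hs1 : s + 1 ≠ 0) (hc : c ≠ 0) (hy0 : y ≠ 0) (hys : y ≠ s)
    (hw : w ^ 3 = (s * (s + 1)) ^ p * ((y ^ 2 + y) * c)) {t : Ω}
    (ht : t = w / (s * (s + 1)) ^ (e + 1)) :
    s = (t ^ 3 - c * (y / s)) / (c * (y / s) ^ 2 - t ^ 3) := by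
  have hq : s * (s + 1) ≠ 0 := mul_ne_zero hs hs1
  -- Here `3 * (e + 1) = p + 1`, so cubing `t` removes the `p`-th power and leaves one factor `s *
  -- (s + 1)` in the denominator.
  have h1 : t ^ 3 * (s * (s + 1)) = (y ^ 2 + y) * c := by
    have h2 : w = t * (s * (s + 1)) ^ (e + 1) := by rw [ht, div_mul_cancel₀ _ (pow_ne_zero _ hq)]
    have h3 : (s * (s + 1)) ^ p * (t ^ 3 * (s * (s + 1))) =
        (s * (s + 1)) ^ p * ((y ^ 2 + y) * c) := by
      rw [← hw, h2, hp]; ring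
    exact mul_left_cancel₀ (pow_ne_zero _ hq) h3
  -- `m` is the slope of the line through the origin, a point of the conic; one factor `s` then
  -- cancels and the equation becomes linear in `s`.
  obtain ⟨m, rfl⟩ : ∃ m, y = m * s := ⟨y / s, (div_mul_cancel₀ _ hs).symm⟩
  rw [mul_div_cancel_right₀ _ hs]
  have hm : m ≠ 0 := fun h => hy0 (by rw [h, zero_mul])
  have hm1 : m ≠ 1 := fun h => hys (by rw [h, one_mul])
  have h2 : s * (c * m ^ 2 - t ^ 3) = t ^ 3 - c * m := by
    apply mul_left_cancel₀ hs
    linear_combination -h1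
  -- If the denominator vanished, so would the numerator, giving `c * m ^ 2 = c * m`, hence `m = 0`
  -- or `m = 1`.
  have h3 : c * m ^ 2 - t ^ 3 ≠ 0 := by
    intro h
    rw [h, mul_zero] at h2
    have : c * m * (m - 1) = 0 := by linear_combination h - h2
    simp [hc, hm, sub_eq_zero, hm1] at this
  rw [eq_div_iff h3, h2]

/-- `L` is obtained by adjoining a `p`-th root `s` of `y 0`. The conic parametrization recovers `s`,
and then all the other generators, from the family `v`. -/
theorem exists_rational_purelyInseparable [IsAlgClosed Ω] {l : ℕ} (hp : p % 3 = 2)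
    {y : Fin (l + 2) → Ω} (hy : IsTranscendenceBasis k y) {w : Ω}
    (hw : w ^ 3 = ∏ i, (y i ^ 2 + y i)) :
    ∃ (L : IntermediateField k Ω) (h : adjoin k (Set.range y ∪ {w}) ≤ L)
      (v : Fin (l + 2) → Ω), RingHomIsPurelyInseparable (inclusion h).toRingHom p ∧
      AlgebraicIndependent k v ∧ L = adjoin k (Set.range v) := by
  classical
  have hprime : p.Prime := Fact.out
  have : CharP Ω p := charP_of_injective_algebraMap (algebraMap k Ω).injective p
  have : ExpChar Ω p := ExpChar.prime Fact.out
  obtain ⟨s, hs⟩ := IsAlgClosed.exists_pow_nat_eq (y 0) hprime.pos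
  set L0 := adjoin k (Set.range y ∪ {w}) with hL0
  have hyL0 (i) : y i ∈ L0 := subset_adjoin _ _ (Or.inl ⟨i, rfl⟩)
  have hwL0 : w ∈ L0 := subset_adjoin _ _ (Or.inr rfl)
  have htr (i) : Transcendental k (y i) := hy.1.transcendental i
  have hy0 (i) : y i ≠ 0 := fun h => htr i (h ▸ isAlgebraic_zero)
  have hy1 (i) : y i + 1 ≠ 0 := fun h => by
    have := htr i
    rw [eq_neg_of_add_eq_zero_left h, ← map_one (algebraMap k Ω), ← map_neg] at this
    exact this (isAlgebraic_algebraMap _)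
  have hyy (i) : y i ^ 2 + y i ≠ 0 := by
    rw [show y i ^ 2 + y i = y i * (y i + 1) by ring]
    exact mul_ne_zero (hy0 i) (hy1 i)
  have hs0 : s ≠ 0 := by rintro rfl; exact hy0 0 (by rw [← hs, zero_pow hprime.ne_zero])
  have hs1 : s + 1 ≠ 0 := fun h => hy1 0 (by
    rw [← hs, ← one_pow p, ← add_pow_char, h, zero_pow hprime.ne_zero])
  have hw0 : w ≠ 0 := by
    rintro rfl
    rw [zero_pow three_ne_zero] at hw
    exact Finset.prod_ne_zero_iff.mpr (fun i _ => hyy i) hw.symm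
  have h3 : (3 : k) ≠ 0 := by
    intro h
    have : ((3 : ℕ) : k) = 0 := by exact_mod_cast h
    rw [CharP.cast_eq_zero_iff k p, Nat.prime_dvd_prime_iff_eq hprime Nat.prime_three] at this
    omega
  -- Over `k(y)` the field `L0` is generated by a cube root, hence separable as `p ≠ 3`. A `p`-th
  -- root of `y 0` in `L0` would thus already lie in the rational function field `k(y)`.
  have hnot (b : L0) : b ^ p ≠ ⟨y 0, hyL0 0⟩ := by
    intro hb
    have hb' : (b : Ω) ^ p = y 0 := congr_arg Subtype.val hb
    let E := adjoin k (Set.range y)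
    have hyE (i) : y i ∈ E := subset_adjoin _ _ ⟨i, rfl⟩
    have hwE : w ^ 3 ∈ E := hw ▸ prod_mem fun i _ => add_mem (pow_mem (hyE i) 2) (hyE i)
    refine pow_ne_of_algebraicIndependent (p := p) hy.1 (E := E) rfl
      (mem_of_pow_mem_of_isSeparable (p := p) (w := w) (isSeparable_of_pow_three h3 hw0 hwE) ?_
        (hb' ▸ hyE 0)) 0 hb'
    have : L0 = E⟮w⟯.restrictScalars k := by
      rw [hL0, adjoin_adjoin_left]
    exact (SetLike.ext_iff.mp this (b : Ω)).mp b.2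
  have hirr := X_pow_sub_C_irreducible_of_prime hprime hnot
  have hmin : minpoly L0 s = Polynomial.X ^ p - Polynomial.C ⟨y 0, hyL0 0⟩ := by
    refine (minpoly.eq_of_irreducible_of_monic hirr ?_
      (Polynomial.monic_X_pow_sub_C _ hprime.ne_zero)).symm
    simp [hs]
  have hL0s : L0 ≤ L0⟮s⟯.restrictScalars k := fun x hx =>
    L0⟮s⟯.algebraMap_mem ⟨x, hx⟩
  obtain ⟨e, he⟩ : ∃ e, p = 3 * e + 2 := ⟨p / 3, by omega⟩
  set t := w / (s * (s + 1)) ^ (e + 1) with ht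
  -- The slope, the normalized cube root, and the untouched coordinates.
  let v : Fin (l + 2) → Ω := Fin.cons (y 1 / s) (Fin.cons t fun i => y i.succ.succ)
  have hv (i) : v i ∈ adjoin k (Set.range v) := subset_adjoin _ _ ⟨i, rfl⟩
  set c := ∏ i : Fin l, (y i.succ.succ ^ 2 + y i.succ.succ) with hc
  have hparam : s = (t ^ 3 - c * (y 1 / s)) / (c * (y 1 / s) ^ 2 - t ^ 3) := by
    refine conic_parametrization he hs0 hs1 (Finset.prod_ne_zero_iff.mpr fun i _ => hyy _) (hy0 1)
      ?_ ?_ ht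
    · rintro rfl
      -- If `y 1 = s`, then `y 1 ^ p = y 0`, against algebraic independence; evaluating at `(1, 0,
      -- …, 0)` separates the two polynomials.
      have : (X 1 ^ p : MvPolynomial (Fin (l + 2)) k) = X 0 := hy.1 (by simpa using hs)
      have := congr(MvPolynomial.eval (fun i => if i = 0 then 1 else 0) $this)
      simp [hprime.ne_zero] at this
    · rw [hw, Fin.prod_univ_succ, Fin.prod_univ_succ, mul_pow, add_pow_char, one_pow, hs, ← hc]
      simp only [Fin.succ_zero_eq_one]
      ring
  have hLs : L0⟮s⟯.restrictScalars k = adjoin k (Set.range v) := by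
    have hsv : s ∈ adjoin k (Set.range v) := by
      have hm : y 1 / s ∈ adjoin k (Set.range v) := hv 0
      have ht' : t ∈ adjoin k (Set.range v) := hv 1
      have hc' : c ∈ adjoin k (Set.range v) := prod_mem fun i _ =>
        add_mem (pow_mem (hv i.succ.succ) 2) (hv i.succ.succ)
      rw [hparam]
      exact div_mem (sub_mem (pow_mem ht' 3) (mul_mem hc' hm))
        (sub_mem (mul_mem hc' (pow_mem hm 2)) (pow_mem ht' 3))
    have hs1v : s + 1 ∈ adjoin k (Set.range v) := add_mem hsv (one_mem _)
    apply le_antisymm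
    · rw [hL0, adjoin_adjoin_left, adjoin_le_iff]
      rintro _ ((⟨i, rfl⟩ | rfl) | rfl)
      · refine Fin.cases ?_ (Fin.cases ?_ fun i => ?_) i
        · rw [← hs]; exact pow_mem hsv p
        · rw [show y (Fin.succ 0) = y 1 / s * s by rw [div_mul_cancel₀ _ hs0]; rfl]
          exact mul_mem (hv 0) hsv
        · exact hv i.succ.succ
      · rw [show _ = t * (s * (s + 1)) ^ (e + 1) from
          (div_mul_cancel₀ _ (pow_ne_zero _ (mul_ne_zero hs0 hs1))).symm]
        exact mul_mem (hv 1) (pow_mem (mul_mem hsv hs1v) _)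
      · exact hsv
    · rw [adjoin_le_iff]
      have hss : s ∈ L0⟮s⟯.restrictScalars k := mem_adjoin_simple_self L0 s
      rintro _ ⟨i, rfl⟩
      refine Fin.cases ?_ (Fin.cases ?_ fun i => ?_) i
      · exact div_mem (hL0s (hyL0 1)) hss
      · exact div_mem (hL0s hwL0) (pow_mem (mul_mem hss (add_mem hss (one_mem _))) _)
      · exact hL0s (hyL0 _)
  refine ⟨L0⟮s⟯.restrictScalars k, hL0s, v, ⟨?_, ?_⟩, ?_, hLs⟩
  · have : ExpChar L0 p := by
      have : CharP L0 p := charP_of_injective_algebraMap (algebraMap k L0).injective p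
      exact ExpChar.prime Fact.out
    exact (isPurelyInseparable_adjoin_simple_iff_pow_mem L0 Ω p).mpr
      ⟨1, ⟨y 0, hyL0 0⟩, by rw [pow_one, hs]; rfl⟩
  · have h1 : Module.finrank L0 L0⟮s⟯ = (minpoly L0 s).natDegree :=
      adjoin.finrank ⟨_, Polynomial.monic_X_pow_sub_C (⟨y 0, hyL0 0⟩ : L0) hprime.ne_zero, by
        simpa [sub_eq_zero] using hs⟩
    rw [hmin, Polynomial.natDegree_X_pow_sub_C] at h1
    exact h1
  -- The `y i` lie in `k(v)`, and `v` has as many members as `y`.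
  · refine (isTranscendenceBasis_of_forall_isAlgebraic hy fun i => ?_).1
    exact isAlgebraic_of_mem_field_adjoin (hLs ▸ hL0s (hyL0 i))

end

/-! ### The coordinate ring of a power of the affine curve. -/

/-- `A` is the coordinate ring of the `n`-th power of the affine curve `y² + y = x³` over `k`, with
coordinate functions `x i` and `y i`. -/
structure IsAffinePower (k : Type u) [Field k] {A : Type u} [CommRing A] [Algebra k A] {n : ℕ}
    (x y : Fin n → A) : Prop where
  rel : ∀ i, y i ^ 2 + y i = x i ^ 3
  adjoin_eq_top : Algebra.adjoin k (Set.range x ∪ Set.range y) = ⊤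
  algebraicIndependent : AlgebraicIndependent k x
  exists_lift : ∀ {B : Type u} [CommRing B] [Algebra k B] (x' y' : Fin n → B),
    (∀ i, y' i ^ 2 + y' i = x' i ^ 3) →
      ∃ f : A →ₐ[k] B, (∀ i, f (x i) = x' i) ∧ ∀ i, f (y i) = y' i

/-- The affine curve `y² + y = x³` over a ring. -/
def affineCurve (R : Type*) [CommRing R] : WeierstrassCurve.Affine R := ⟨0, 0, 1, 0, 0⟩

lemma affineCurve_polynomial (R : Type*) [CommRing R] : (affineCurve R).polynomial =
    Polynomial.X ^ 2 + Polynomial.X - Polynomial.C (Polynomial.X ^ 3) := by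
  simp [affineCurve, WeierstrassCurve.Affine.polynomial]

/-- The curve over `A` adds one factor, whose coordinates are put first. The polynomial ring `A[X]`
embeds in its coordinate ring, which gives independence of the enlarged family of `x` coordinates.
-/
lemma IsAffinePower.succ {k A : Type u} [Field k] [CommRing A] [Algebra k A] [IsDomain A]
    {n : ℕ} {x y : Fin n → A} (h : IsAffinePower k x y) :
    IsAffinePower k (A := (affineCurve A).CoordinateRing)
      (Fin.cons (AdjoinRoot.of (affineCurve A).polynomial Polynomial.X)
        (algebraMap A (affineCurve A).CoordinateRing ∘ x))
      (Fin.cons (AdjoinRoot.root (affineCurve A).polynomial)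
        (algebraMap A (affineCurve A).CoordinateRing ∘ y)) where
  rel := by
    refine Fin.cases ?_ fun i => ?_
    · have := (congr_arg (AdjoinRoot.mk (affineCurve A).polynomial)
        (affineCurve_polynomial A)).symm.trans AdjoinRoot.mk_self
      rw [map_sub, map_add, map_pow, AdjoinRoot.mk_X, AdjoinRoot.mk_C, map_pow] at this
      exact sub_eq_zero.mp this
    · simp only [Fin.cons_succ, Function.comp_apply, ← map_pow, ← map_add, h.rel]
  adjoin_eq_top := by
    set S : Subalgebra k (affineCurve A).CoordinateRing := Algebra.adjoin k _ with hS
    have hX : AdjoinRoot.of (affineCurve A).polynomial Polynomial.X ∈ S :=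
      Algebra.subset_adjoin (Or.inl ⟨0, rfl⟩)
    have hY : AdjoinRoot.root (affineCurve A).polynomial ∈ S :=
      Algebra.subset_adjoin (Or.inr ⟨0, rfl⟩)
    have hA (a : A) : algebraMap A (affineCurve A).CoordinateRing a ∈ S := by
      have h1 : (⊤ : Subalgebra k A).map
          (IsScalarTower.toAlgHom k A (affineCurve A).CoordinateRing) ≤ S := by
        rw [← h.adjoin_eq_top, AlgHom.map_adjoin, Algebra.adjoin_le_iff]
        rintro _ ⟨_, ⟨i, rfl⟩ | ⟨i, rfl⟩, rfl⟩
        · exact Algebra.subset_adjoin (Or.inl ⟨i.succ, rfl⟩)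
        · exact Algebra.subset_adjoin (Or.inr ⟨i.succ, rfl⟩)
      exact h1 ⟨a, trivial, rfl⟩
    have hAX (f : Polynomial A) : AdjoinRoot.of (affineCurve A).polynomial f ∈ S := by
      induction f using Polynomial.induction_on' with
      | add f g hf hg => rw [map_add]; exact add_mem hf hg
      | monomial m a =>
        rw [← Polynomial.C_mul_X_pow_eq_monomial, map_mul, map_pow]
        exact mul_mem (hA a) (pow_mem hX m)
    refine eq_top_iff.mpr fun z _ => ?_
    induction z using AdjoinRoot.induction_on with
    | ih f =>
      induction f using Polynomial.induction_on' with
      | add f g hf hg => rw [map_add]; exact add_mem (hf trivial) (hg trivial)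
      | monomial m a =>
        rw [← Polynomial.C_mul_X_pow_eq_monomial, map_mul, map_pow, AdjoinRoot.mk_C,
          AdjoinRoot.mk_X]
        exact mul_mem (hAX a) (pow_mem hY m)
  algebraicIndependent := by
    have h1 : Function.Injective (algebraMap (Polynomial A) (affineCurve A).CoordinateRing) :=
      FaithfulSMul.algebraMap_injective _ _
    -- Polynomials in `n + 1` variables are viewed as polynomials in the first one, with
    -- coefficients in the other `n`.
    have h2 : Function.Injective (Polynomial.map (aeval x : MvPolynomial (Fin n) k →ₐ[k] A).toRingHom) :=
      Polynomial.map_injective _ h.algebraicIndependent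
    refine fun f g hfg => (MvPolynomial.finSuccEquiv k n).injective (h2 (h1 ?_))
    have key (f : MvPolynomial (Fin (n + 1)) k) : algebraMap (Polynomial A) (affineCurve A).CoordinateRing
        (Polynomial.map (aeval x : MvPolynomial (Fin n) k →ₐ[k] A).toRingHom
          (MvPolynomial.finSuccEquiv k n f)) =
        aeval (Fin.cons (AdjoinRoot.of (affineCurve A).polynomial Polynomial.X)
        (algebraMap A (affineCurve A).CoordinateRing ∘ x)) f := by
      induction f using MvPolynomial.induction_on with
      | C a =>
        rw [MvPolynomial.finSuccEquiv_apply, MvPolynomial.eval₂Hom_C, MvPolynomial.aeval_C]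
        simp
        rfl
      | add f g hf hg => simp only [map_add, hf, hg, Polynomial.map_add]
      | mul_X f i hf =>
        rw [map_mul, map_mul, Polynomial.map_mul, map_mul, hf, aeval_X]
        congr 1
        refine Fin.cases ?_ (fun i => ?_) i
        · simp [MvPolynomial.finSuccEquiv_X_zero]
        · simp [MvPolynomial.finSuccEquiv_X_succ]
          rfl
    rw [key, key]
    exact hfg
  exists_lift {B} _ _ x' y' h' := by
    obtain ⟨f, hfx, hfy⟩ := h.exists_lift (fun i => x' i.succ) (fun i => y' i.succ)
      fun i => h' i.succ
    let g : Polynomial A →+* B := Polynomial.eval₂RingHom f (x' 0)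
    have hg : (affineCurve A).polynomial.eval₂ g (y' 0) = 0 := by
      rw [affineCurve_polynomial]
      rw [Polynomial.eval₂_sub, Polynomial.eval₂_add, Polynomial.eval₂_pow, Polynomial.eval₂_X,
        Polynomial.eval₂_C, map_pow, sub_eq_zero, h']
      simp [g]
    let φ : (affineCurve A).CoordinateRing →+* B := AdjoinRoot.lift g (y' 0) hg
    have hφ (a : A) : φ (algebraMap A (affineCurve A).CoordinateRing a) = f a := by
      have : φ (AdjoinRoot.of _ (Polynomial.C a)) = f a := by
        simp [φ, g]
      exact this
    refine ⟨⟨φ, fun c => ?_⟩, Fin.cases ?_ fun i => ?_, Fin.cases ?_ fun i => ?_⟩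
    · refine Eq.trans ?_ (f.commutes c)
      exact hφ (algebraMap k A c)
    · simp [φ, g]
    · simp [hφ, hfx]
    · simp [φ, g]
    · simp [hφ, hfy]

/-- Induction from `k` itself. Being a domain is carried along, since the coordinate ring of a
Weierstrass curve over a domain is a domain; it provides the fraction field later. -/
lemma exists_isAffinePower (k : Type u) [Field k] (n : ℕ) :
    ∃ (A : Type u) (_ : CommRing A) (_ : Algebra k A) (_ : IsDomain A) (x y : Fin n → A),
      IsAffinePower k x y := by
  induction n with
  | zero =>
    refine ⟨k, inferInstance, inferInstance, inferInstance, Fin.elim0, Fin.elim0, fun i => i.elim0,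
      Subsingleton.elim _ _, ?_, fun {B} _ _ _ _ _ =>
        ⟨Algebra.ofId k B, fun i => i.elim0, fun i => i.elim0⟩⟩
    exact algebraicIndependent_empty_type_iff.mpr Function.injective_id
  | succ n ih =>
    obtain ⟨A, _, _, _, x, y, h⟩ := ih
    exact ⟨_, inferInstance, inferInstance, inferInstance, _, _, h.succ⟩

/-! ### Invariants of the diagonal group on the function field. -/

section
open IntermediateField
variable {k K : Type*} [Field k] [Field K] [Algebra k K]

/-- As `x` is integral over `E`, the field `E⟮x⟯` equals `E[x]`, and powers of `x` reduce modulo `x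
^ 3 ∈ E`. -/
lemma exists_eq_of_mem_adjoin_cube_root {E : IntermediateField k K} {x z : K} (hx : x ^ 3 ∈ E)
    (hz : z ∈ E⟮x⟯) : ∃ a b c : E, z = a + b * x + c * x ^ 2 := by
  have hr_int : IsIntegral E x := by
    refine IsIntegral.of_pow three_pos ?_
    exact isIntegral_algebraMap (x := (⟨_, hx⟩ : E))
  rw [← mem_toSubalgebra, adjoin_simple_toSubalgebra_of_isAlgebraic hr_int.isAlgebraic] at hz
  induction hz using Algebra.adjoin_induction with
  | mem z hz =>
    obtain rfl := hz
    exact ⟨0, 1, 0, by simp⟩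
  | algebraMap r => exact ⟨r, 0, 0, by simp⟩
  | add z w _ _ hz hw =>
    obtain ⟨a, b, c, rfl⟩ := hz
    obtain ⟨a', b', c', rfl⟩ := hw
    exact ⟨a + a', b + b', c + c', by push_cast; ring⟩
  | mul z w _ _ hz hw =>
    obtain ⟨a, b, c, rfl⟩ := hz
    obtain ⟨a', b', c', rfl⟩ := hw
    refine ⟨a * a' + (b * c' + c * b') * ⟨x ^ 3, hx⟩, a * b' + b * a' + c * c' * ⟨x ^ 3, hx⟩,
      a * c' + b * b' + c * a', ?_⟩
    push_cast
    ring

lemma map_eq_of_mem_adjoin {s : Set K} (σ : K →ₐ[k] K) (hσ : ∀ x ∈ s, σ x = x) {z : K}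
    (hz : z ∈ adjoin k s) : σ z = z := by
  induction hz using adjoin_induction with
  | mem x hx => exact hσ x hx
  | algebraMap r => exact σ.commutes r
  | add x y _ _ hx hy => rw [map_add, hx, hy]
  | inv x _ hx => rw [map_inv₀, hx]
  | mul x y _ _ hx hy => rw [map_mul, hx, hy]

/-- Write `z = a + b x + c x²` and average over `1`, `σ`, `σ²`: the terms in `x` and `x²` cancel
because `1 + ω + ω² = 0`, so `3 z = 3 a`. -/
lemma mem_of_map_eq {ζ : k} (hζ : IsPrimitiveRoot ζ 3) (h3 : (3 : k) ≠ 0)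
    {E : IntermediateField k K} {x z : K} (hx : x ^ 3 ∈ E) (hz : z ∈ E⟮x⟯) (σ : K →ₐ[k] K)
    (hσ : ∀ e ∈ E, σ e = e) (hσx : σ x = algebraMap k K ζ * x) (hσz : σ z = z) : z ∈ E := by
  obtain ⟨a, b, c, rfl⟩ := exists_eq_of_mem_adjoin_cube_root hx hz
  set ω := algebraMap k K ζ
  have hω : 1 + ω + ω ^ 2 = 0 := by
    have := hζ.geom_sum_eq_zero (by norm_num)
    simp only [Finset.sum_range_succ, Finset.sum_range_zero, pow_zero, pow_one, zero_add] at this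
    simpa using congr(algebraMap k K $this)
  have h1 : (a + b * x + c * x ^ 2 : K) = a + b * (ω * x) + c * (ω * x) ^ 2 := by
    conv_lhs => rw [← hσz]
    rw [map_add, map_add, map_mul, map_mul, map_pow, hσx, hσ _ a.2, hσ _ b.2, hσ _ c.2]
  have h2 : (a + b * x + c * x ^ 2 : K) =
      a + b * (ω * (ω * x)) + c * (ω * (ω * x)) ^ 2 := by
    conv_lhs => rw [h1, ← hσx, ← map_pow, ← hσ _ a.2, ← hσ _ b.2, ← hσ _ c.2, ← map_mul, ← map_mul,
      ← map_add, ← map_add, h1]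
    simp only [map_add, map_mul, map_pow, hσx, hσ _ a.2, hσ _ b.2, hσ _ c.2]
    rw [show σ ω = ω from σ.commutes ζ]
  have h3' : (3 : K) ≠ 0 := by
    intro h
    apply h3
    apply (algebraMap k K).injective
    rw [map_ofNat, h, map_zero]
  have : (a + b * x + c * x ^ 2 : K) = a := by
    apply mul_left_cancel₀ h3'
    linear_combination h1 + h2 + (b * x + c * x ^ 2 * (1 - ω + ω ^ 2)) * hω
  rw [this]
  exact a.2

/-- The invariants of the diagonal group of `x ↦ ζ^a x`, `∑ a = 0`, in `k(x, y)`. -/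
theorem mem_adjoin_of_forall_map_eq {ζ : k} (hζ : IsPrimitiveRoot ζ 3) (h3 : (3 : k) ≠ 0) {l : ℕ}
    {x y : Fin (l + 1) → K} (hxy : ∀ i, y i ^ 2 + y i = x i ^ 3) (hx : ∀ i, x i ≠ 0)
    (htop : adjoin k (Set.range x ∪ Set.range y) = ⊤) (σ : Fin l → K →ₐ[k] K)
    (hσy : ∀ j i, σ j (y i) = y i) (hσj : ∀ j, σ j (x j.castSucc) = algebraMap k K ζ * x j.castSucc)
    (hσi : ∀ j i, i ≠ j → σ j (x i.castSucc) = x i.castSucc)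
    (hσw : ∀ j, σ j (∏ i, x i) = ∏ i, x i) {z : K} (hz : ∀ j, σ j z = z) :
    z ∈ adjoin k (Set.range y ∪ {∏ i, x i}) := by
  -- `S 0` generates `K` and `S l` is the target. Passing from `S m` to `S (m + 1)` removes the
  -- single cube root `x m`, using invariance under `σ m`.
  let S (m : ℕ) : Set K := (Set.range y ∪ {∏ i, x i}) ∪ {a | ∃ i : Fin l, m ≤ i ∧ a = x i.castSucc}
  have hy (m : ℕ) (i) : y i ∈ adjoin k (S m) := subset_adjoin _ _ (Or.inl (Or.inl ⟨i, rfl⟩))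
  have key (m : ℕ) (hm : m ≤ l) : z ∈ adjoin k (S m) := by
    induction m with
    | zero =>
      have hx' (i : Fin l) : x i.castSucc ∈ adjoin k (S 0) :=
        subset_adjoin _ _ (Or.inr ⟨i, Nat.zero_le _, rfl⟩)
      have : adjoin k (Set.range x ∪ Set.range y) ≤ adjoin k (S 0) := by
        rw [adjoin_le_iff]
        rintro _ (⟨i, rfl⟩ | ⟨i, rfl⟩)
        · refine Fin.lastCases ?_ (fun i => hx' i) i
          -- The last coordinate is never listed in `S m`; it is the product divided by the others.
          have h1 : x (Fin.last l) = (∏ i, x i) / ∏ i : Fin l, x i.castSucc := by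
            rw [Fin.prod_univ_castSucc, mul_comm,
              mul_div_cancel_right₀ _ (Finset.prod_ne_zero_iff.mpr fun i _ => hx _)]
          rw [h1]
          exact div_mem (subset_adjoin _ _ (Or.inl (Or.inr rfl))) (prod_mem fun i _ => hx' i)
        · exact hy 0 i
      rw [htop] at this
      exact this trivial
    | succ m ih =>
      let j : Fin l := ⟨m, hm⟩
      refine mem_of_map_eq hζ h3 (x := x j.castSucc) ?_ ?_ (σ j) ?_ (hσj j) (hz j)
      · rw [← hxy]
        exact add_mem (pow_mem (hy _ _) 2) (hy _ _)
      · have h1 : adjoin k (S m) ≤ (adjoin k (S (m + 1)))⟮x j.castSucc⟯.restrictScalars k := by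
          rw [adjoin_adjoin_left]
          refine adjoin.mono k _ _ ?_
          rintro _ (h | ⟨i, hi, rfl⟩)
          · exact Or.inl (Or.inl h)
          · rcases hi.eq_or_lt with h | h
            · refine Or.inr ?_
              rw [show i = j from Fin.ext h.symm]
              rfl
            · exact Or.inl (Or.inr ⟨i, h, rfl⟩)
        exact h1 (ih (by omega))
      · refine fun e he => map_eq_of_mem_adjoin (σ j) ?_ he
        rintro _ ((⟨i, rfl⟩ | rfl) | ⟨i, hi, rfl⟩)
        · exact hσy j i
        · exact hσw j
        · exact hσi j i (by rintro rfl; simp [j] at hi)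
  have h1 := key l le_rfl
  have h2 : S l = Set.range y ∪ {∏ i, x i} := by
    refine Set.union_eq_self_of_subset_right ?_
    rintro _ ⟨i, hi, rfl⟩
    exact absurd i.2 (by omega)
  rwa [h2] at h1

end

/-! ### Standard affine charts of `Proj`. -/

section Away
open HomogeneousLocalization
variable {k A : Type u} [Field k] [CommRing A] [Algebra k A] (𝒜 : ℕ → Submodule k A)
  [GradedAlgebra 𝒜] (f : A)

/-- The structure map passes through degree zero, to match the structure morphism of `projOver`. -/
instance awayAlgebra : Algebra k (Away 𝒜 f) :=
  ((fromZeroRingHom 𝒜 (Submonoid.powers f)).comp (algebraMap k (𝒜 0))).toAlgebra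

/-- The inclusion of the degree zero part of `A[1/f]` into `A[1/f]`. -/
def awayVal : Away 𝒜 f →ₐ[k] Localization.Away f where
  __ := algebraMap (Away 𝒜 f) (Localization.Away f)
  commutes' _ := rfl

variable {f}

lemma awayVal_mk {d : ℕ} (hf : f ∈ 𝒜 d) (n : ℕ) (a : A) (ha : a ∈ 𝒜 (n • d)) :
    awayVal 𝒜 f (Away.mk 𝒜 hf n a ha) = Localization.mk a (⟨f ^ n, n, rfl⟩ : Submonoid.powers f) := rfl

lemma awayVal_injective : Function.Injective (awayVal 𝒜 f) :=
  HomogeneousLocalization.val_injective _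

/-- The chart `f ≠ 0` of `Proj`. -/
def awayChart {d : ℕ} (hf : f ∈ 𝒜 d) (hd : 0 < d) :
    Spec (.of (Away 𝒜 f)) ⟶ (projOver 𝒜).left :=
  Proj.awayι 𝒜 f hf hd

instance {d : ℕ} (hf : f ∈ 𝒜 d) (hd : 0 < d) : IsOpenImmersion (awayChart 𝒜 hf hd) :=
  inferInstanceAs (IsOpenImmersion (Proj.awayι 𝒜 f hf hd))

lemma awayChart_comp_hom {d : ℕ} (hf : f ∈ 𝒜 d) (hd : 0 < d) :
    awayChart 𝒜 hf hd ≫ (projOver 𝒜).hom =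
      Spec.map (CommRingCat.ofHom (algebraMap k (Away 𝒜 f))) := by
  simp only [projOver, Over.mk_hom]
  exact (Proj.awayι_toSpecZero_assoc _ _ _ _ _).trans (Spec.map_comp _ _).symm

lemma exists_chart_of_algEquiv {d : ℕ} (hf : f ∈ 𝒜 d) (hd : 0 < d) {R : Type u} [CommRing R]
    [Algebra k R] (e : Away 𝒜 f ≃ₐ[k] R) :
    ∃ j : Spec (.of R) ⟶ (projOver 𝒜).left, IsOpenImmersion j ∧ j ≫ (projOver 𝒜).hom =
      Spec.map (CommRingCat.ofHom (algebraMap k R)) := by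
  let t : CommRingCat.of (Away 𝒜 f) ⟶ .of R := e.toRingEquiv.toCommRingCatIso.hom
  have ht : CommRingCat.ofHom (algebraMap k (Away 𝒜 f)) ≫ t =
      CommRingCat.ofHom (algebraMap k R) := by
    ext c : 2
    exact e.commutes c
  refine ⟨Spec.map t ≫ awayChart 𝒜 hf hd, inferInstance, ?_⟩
  rw [← ht, Spec.map_comp, Category.assoc, awayChart_comp_hom]

variable {B : Type*} [CommRing B] [Algebra k B]

/-- Dehomogenization: a homomorphism with `f ↦ 1` extends to the degree zero part of `A[1/f]`. -/
def awayLift (g : A →ₐ[k] B) (hg : g f = 1) : Away 𝒜 f →ₐ[k] B :=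
  (IsLocalization.liftAlgHom (M := Submonoid.powers f) (S := Localization.Away f) (f := g) (by
    rintro ⟨_, n, rfl⟩
    simp [hg])).comp (awayVal 𝒜 f)

lemma awayLift_mk (g : A →ₐ[k] B) (hg : g f = 1) {d : ℕ} (hf : f ∈ 𝒜 d) (n : ℕ) (a : A)
    (ha : a ∈ 𝒜 (n • d)) : awayLift 𝒜 g hg (Away.mk 𝒜 hf n a ha) = g a := by
  rw [awayLift, AlgHom.comp_apply, awayVal_mk, Localization.mk_eq_mk',
    IsLocalization.liftAlgHom_apply, IsLocalization.lift_mk'_spec]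
  simp [hg]

lemma aeval_mul_of_isHomogeneous {σ : Type*} {F : MvPolynomial σ k} {d : ℕ}
    (hF : F.IsHomogeneous d) (r : B) (g : σ → B) :
    aeval (fun i => r * g i) F = r ^ d * aeval g F := by
  rw [aeval_def, aeval_def, eval₂_eq, eval₂_eq, Finset.mul_sum]
  refine Finset.sum_congr rfl fun m hm => ?_
  simp only [mul_pow, Finset.prod_mul_distrib, Finset.prod_pow_eq_pow_sum]
  rw [hF.degree_eq_sum_deg_support hm]
  ring

/-- This is `F / f ^ d = F(X i / f)`, checked inside `A[1/f]` after multiplying by `f ^ d`. -/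
lemma away_mk_eq_aeval {σ : Type*} (π : MvPolynomial σ k →ₐ[k] A) (hπ : ∀ i, π (X i) ∈ 𝒜 1)
    (hf : f ∈ 𝒜 1) (d : ℕ) {F : MvPolynomial σ k} (hF : F.IsHomogeneous d)
    (hd : π F ∈ 𝒜 (d • 1)) :
    Away.mk 𝒜 hf d (π F) hd = aeval (fun i => Away.mk 𝒜 hf 1 (π (X i)) (hπ i)) F := by
  apply awayVal_injective
  rw [awayVal_mk, ← AlgHom.comp_apply, comp_aeval]
  have hu : (algebraMap A (Localization.Away f) f) ^ d *
      aeval (fun i => awayVal 𝒜 f (Away.mk 𝒜 hf 1 (π (X i)) (hπ i))) F =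
      algebraMap A (Localization.Away f) (π F) := by
    rw [← aeval_mul_of_isHomogeneous hF]
    have h1 (i) : algebraMap A (Localization.Away f) f *
        awayVal 𝒜 f (Away.mk 𝒜 hf 1 (π (X i)) (hπ i)) = algebraMap A _ (π (X i)) := by
      rw [awayVal_mk, Localization.mk_eq_mk', mul_comm]
      convert! IsLocalization.mk'_spec (Localization.Away f) (π (X i)) _ using 3
      simp
    simp only [h1]
    rw [← IsScalarTower.toAlgHom_apply k A (Localization.Away f), ← AlgHom.comp_apply]
    congr 1
    ext i
    simp
  rw [Localization.mk_eq_mk', IsLocalization.mk'_eq_iff_eq_mul, ← hu, map_pow, mul_comm]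

/-- The degree zero part of `A[1/f]` is generated by the quotients of the generators of `A` by
`f`. -/
lemma away_adjoin_eq_top {σ : Type*} (π : MvPolynomial σ k →ₐ[k] A) (hπ : ∀ i, π (X i) ∈ 𝒜 1)
    (hs : ∀ d, ∀ a ∈ 𝒜 d, ∃ F : MvPolynomial σ k, F.IsHomogeneous d ∧ π F = a) (hf : f ∈ 𝒜 1) :
    (aeval (R := k) fun i => Away.mk 𝒜 hf 1 (π (X i)) (hπ i)).range = ⊤ := by
  refine eq_top_iff.mpr fun z _ => ?_
  obtain ⟨d, a, ha, rfl⟩ := Away.mk_surjective 𝒜 hf z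
  obtain ⟨F, hF, rfl⟩ := hs _ a ha
  refine ⟨F, ?_⟩
  exact (away_mk_eq_aeval 𝒜 π hπ hf d (by simpa using hF) ha).symm

end Away

/-! ### The function field computed on an affine chart. -/

section FunctionField

/-- An open immersion preserves generic points and induces an isomorphism of stalks there; the
generic stalk of `Spec R` is the fraction ring. -/
lemma exists_fractionRing_equiv_functionField {k : Type u} [Field k] (R : CommRingCat.{u})
    [IsDomain R] [Algebra k R] (X : Over (Spec (.of k))) [IsIntegral X.left] (j : Spec R ⟶ X.left)
    [IsOpenImmersion j] (hj : j ≫ X.hom = Spec.map (CommRingCat.ofHom (algebraMap k R))) :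
    ∃ e : FractionRing R ≃+* X.left.functionField,
      ∀ c, e (algebraMap k (FractionRing R) c) = toFunctionField X c := by
  have hgen : j (genericPoint (Spec R)) = genericPoint X.left :=
    genericPoint_eq_of_isOpenImmersion j
  have : IsIso (X.left.presheaf.stalkSpecializes (specializes_of_eq hgen)) :=
    (X.left.presheaf.stalkCongr (.of_eq hgen.symm)).isIso_hom
  let i := asIso (X.left.presheaf.stalkSpecializes (specializes_of_eq hgen) ≫
    j.stalkMap (genericPoint (Spec R)))
  let a : FractionRing R ≃ₐ[R] (Spec R).functionField :=
    FractionRing.algEquiv R (Spec R).functionField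
  have key : CommRingCat.ofHom (toFunctionField X) ≫ i.hom =
      CommRingCat.ofHom (algebraMap k R) ≫ CommRingCat.ofHom (algebraMap R (Spec R).functionField) := by
    apply Spec.map_injective
    rw [Spec.map_comp, Spec.map_comp, ← fromSpecStalk_genericPoint_comp_hom, ← hj]
    have h1 : Spec.map i.hom ≫ X.left.fromSpecStalk (genericPoint X.left) =
        (Spec R).fromSpecStalk (genericPoint (Spec R)) ≫ j := by
      simp only [i, asIso_hom]
      rw [Spec.map_comp, Category.assoc, Scheme.SpecMap_stalkSpecializes_fromSpecStalk,
        Scheme.SpecMap_stalkMap_fromSpecStalk]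
    rw [reassoc_of% h1, Spec.fromSpecStalk_eq']
    rfl
  refine ⟨a.toRingEquiv.trans i.commRingCatIsoToRingEquiv.symm, fun c => ?_⟩
  rw [RingEquiv.trans_apply, RingEquiv.symm_apply_eq]
  have h2 := congr($key c)
  refine Eq.trans ?_ h2.symm
  have h3 : algebraMap k (FractionRing R) c = algebraMap R (FractionRing R) (algebraMap k R c) := rfl
  rw [h3]
  exact a.commutes _

end FunctionField

/-! ### Projective space: integrality and an affine chart. -/

section ProjectiveSpace
attribute [local instance] MvPolynomial.gradedAlgebra
variable (k : Type u) [Field k] (n : ℕ)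

instance isReduced_projectiveSpace : IsReduced (projectiveSpace k n).left := by
  have h (i) : IsReduced
      ((Proj.affineOpenCover (homogeneousSubmodule (Fin (n + 1)) k)).openCover.X i) := by
    have : _root_.IsReduced (HomogeneousLocalization.Away (homogeneousSubmodule (Fin (n + 1)) k)
        (i.2 : MvPolynomial (Fin (n + 1)) k)) :=
      isReduced_of_injective (awayVal (homogeneousSubmodule (Fin (n + 1)) k)
        (i.2 : MvPolynomial (Fin (n + 1)) k)) (awayVal_injective _)
    change IsReduced (Spec (.of (HomogeneousLocalization.Away _ _)))
    infer_instance
  exact IsReduced.of_openCover _ (Proj.affineOpenCover (homogeneousSubmodule (Fin (n + 1)) k)).openCover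

instance isIntegral_projectiveSpace : IsIntegral (projectiveSpace k n).left :=
  isIntegral_of_irreducibleSpace_of_isReduced _

/-- The chart `X₀ ≠ 0` of projective space is affine space. -/
lemma exists_projectiveSpace_chart : ∃ j : Spec (.of (MvPolynomial (Fin n) k)) ⟶
    (projectiveSpace k n).left, IsOpenImmersion j ∧ j ≫ (projectiveSpace k n).hom =
      Spec.map (CommRingCat.ofHom (algebraMap k (MvPolynomial (Fin n) k))) := by
  let 𝒜 := homogeneousSubmodule (Fin (n + 1)) k
  have hX (i : Fin (n + 1)) : (X i : MvPolynomial (Fin (n + 1)) k) ∈ 𝒜 1 := isHomogeneous_X k i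
  let g : MvPolynomial (Fin (n + 1)) k →ₐ[k] MvPolynomial (Fin n) k := aeval (Fin.cons 1 X)
  have hg : g (X 0) = 1 := by simp [g]
  let u (i : Fin (n + 1)) : HomogeneousLocalization.Away 𝒜 (X 0) :=
    .mk 𝒜 (hX 0) 1 (X i) (hX i)
  have hu0 : u 0 = 1 := by
    apply awayVal_injective
    rw [awayVal_mk, map_one]
    convert! Localization.mk_self
      (⟨X 0 ^ 1, 1, rfl⟩ : Submonoid.powers (X 0 : MvPolynomial (Fin (n + 1)) k)) using 2
    simp
  let e : MvPolynomial (Fin n) k ≃ₐ[k] HomogeneousLocalization.Away 𝒜 (X 0) :=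
    AlgEquiv.ofBijective (aeval fun i => u i.succ) ⟨by
      -- Dehomogenization `X 0 ↦ 1` is a left inverse.
      refine Function.LeftInverse.injective (g := awayLift 𝒜 g hg) fun F => ?_
      rw [← AlgHom.comp_apply, comp_aeval]
      simp only [u, awayLift_mk]
      simp [g], by
      have h := away_adjoin_eq_top 𝒜 (AlgHom.id k _) hX (fun d a ha => ⟨a, ha, rfl⟩) (hX 0)
      intro z
      obtain ⟨F, rfl⟩ : z ∈ (aeval (R := k) u).range := h ▸ trivial
      refine ⟨g F, ?_⟩
      rw [← AlgHom.comp_apply, comp_aeval]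
      congr 2
      refine funext (Fin.cases ?_ fun i => ?_)
      · simp [hu0]
      · simp⟩
  exact exists_chart_of_algEquiv 𝒜 (hX 0) one_pos e.symm

end ProjectiveSpace

/-! ### The affine chart of the cubic and the action of scaling on it. -/

section CurveChart
open HomogeneousLocalization
attribute [local instance] MvPolynomial.gradedAlgebra
variable (k : Type u) [Field k]

lemma mk_X_mem_coordGrading (i : Fin 3) :
    Ideal.Quotient.mkₐ k (Ideal.span {cubic k}) (X i) ∈ coordGrading k 1 :=
  ⟨X i, isHomogeneous_X k i, rfl⟩

/-- The coordinate ring of the affine chart `Z ≠ 0` of `E₃`. -/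
abbrev e3Ring : Type u :=
  Away (coordGrading k) (Ideal.Quotient.mkₐ k (Ideal.span {cubic k}) (X 2))

/-- The functions `X / Z`, `Y / Z`, `Z / Z` on the affine chart `Z ≠ 0` of `E₃`. -/
def e3Coord (i : Fin 3) : e3Ring k :=
  Away.mk (coordGrading k) (mk_X_mem_coordGrading k 2) 1
    (Ideal.Quotient.mkₐ k (Ideal.span {cubic k}) (X i)) (mk_X_mem_coordGrading k i)

lemma e3Coord_two : e3Coord k 2 = 1 := by
  apply awayVal_injective
  rw [e3Coord, awayVal_mk, map_one, Localization.mk_eq_mk', IsLocalization.mk'_eq_iff_eq_mul, one_mul]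
  exact congr_arg (algebraMap _ _) (pow_one _).symm

lemma aeval_e3Coord {d : ℕ} {F : MvPolynomial (Fin 3) k} (hF : F.IsHomogeneous d) :
    aeval (e3Coord k) F = Away.mk (coordGrading k) (mk_X_mem_coordGrading k 2) d
      (Ideal.Quotient.mkₐ k (Ideal.span {cubic k}) F) (by simpa using ⟨F, hF, rfl⟩) :=
  (away_mk_eq_aeval (coordGrading k) (Ideal.Quotient.mkₐ k (Ideal.span {cubic k}))
    (mk_X_mem_coordGrading k) (mk_X_mem_coordGrading k 2) d hF _).symm

lemma e3Coord_rel : e3Coord k 1 ^ 2 + e3Coord k 1 = e3Coord k 0 ^ 3 := by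
  have h1 := aeval_e3Coord k (cubic_isHomogeneous k)
  have h2 : Ideal.Quotient.mkₐ k (Ideal.span {cubic k}) (cubic k) = 0 :=
    Ideal.Quotient.eq_zero_iff_mem.mpr (Ideal.mem_span_singleton_self _)
  have h3 : aeval (e3Coord k) (cubic k) = 0 := by
    rw [h1]
    apply awayVal_injective
    rw [awayVal_mk, h2, map_zero, Localization.mk_zero]
  simpa [cubic, e3Coord_two, sub_eq_zero] using h3

variable {k} {B : Type u} [CommRing B] [Algebra k B]

lemma e3Ring_hom_ext {f g : e3Ring k →ₐ[k] B} (h0 : f (e3Coord k 0) = g (e3Coord k 0))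
    (h1 : f (e3Coord k 1) = g (e3Coord k 1)) : f = g := by
  have htop : (aeval (R := k) (e3Coord k)).range = ⊤ :=
    away_adjoin_eq_top (coordGrading k) (Ideal.Quotient.mkₐ k (Ideal.span {cubic k}))
      (mk_X_mem_coordGrading k) (by rintro d _ ⟨F, hF, rfl⟩; exact ⟨F, hF, rfl⟩)
      (mk_X_mem_coordGrading k 2)
  ext z
  obtain ⟨F, rfl⟩ : z ∈ (aeval (R := k) (e3Coord k)).range := htop ▸ trivial
  change f (aeval (e3Coord k) F) = g (aeval (e3Coord k) F)
  rw [← AlgHom.comp_apply, ← AlgHom.comp_apply, comp_aeval, comp_aeval]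
  congr 2
  funext i
  fin_cases i
  · exact h0
  · exact h1
  · simp [e3Coord_two]

/-- With `e3Ring_hom_ext`, this makes `e3Ring k` the universal `k`-algebra with a solution of `y ^ 2
+ y = x ^ 3`. -/
lemma exists_e3Ring_lift {x y : B} (h : y ^ 2 + y = x ^ 3) :
    ∃ f : e3Ring k →ₐ[k] B, f (e3Coord k 0) = x ∧ f (e3Coord k 1) = y := by
  let g : (MvPolynomial (Fin 3) k ⧸ Ideal.span {cubic k}) →ₐ[k] B :=
    Ideal.Quotient.liftₐ _ (aeval ![x, y, 1]) fun a ha => by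
      obtain ⟨b, rfl⟩ := Ideal.mem_span_singleton.mp ha
      rw [map_mul]
      simp [cubic, h]
  have hg (i) : g (Ideal.Quotient.mkₐ k (Ideal.span {cubic k}) (X i)) = ![x, y, 1] i := by
    have : g (Ideal.Quotient.mkₐ k (Ideal.span {cubic k}) (X i)) = aeval ![x, y, 1] (X i) := rfl
    rw [this, aeval_X]
  exact ⟨awayLift (coordGrading k) g (by simpa using hg 2),
    (awayLift_mk _ _ _ _ _ _ _).trans (hg 0), (awayLift_mk _ _ _ _ _ _ _).trans (hg 1)⟩

variable (k) in
/-- The affine chart `Z ≠ 0` of `E₃`. -/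
def e3Chart : Spec (.of (e3Ring k)) ⟶ (E3 k).left :=
  awayChart (coordGrading k) (mk_X_mem_coordGrading k 2) one_pos

instance : IsOpenImmersion (e3Chart k) :=
  inferInstanceAs (IsOpenImmersion (awayChart _ _ _))

lemma e3Chart_comp_hom : e3Chart k ≫ (E3 k).hom =
    Spec.map (CommRingCat.ofHom (algebraMap k (e3Ring k))) :=
  awayChart_comp_hom _ _ _

/-- Keeping `f s = t` as a hypothesis allows `t` to be `s` itself when `f` fixes `s`, without
transport between the rings `Away 𝒜 (f s)` and `Away 𝒜 s`. -/
lemma exists_awayι_comp_map {A : Type u} [CommRing A] [Algebra k A] {𝒜 : ℕ → Submodule k A}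
    [GradedAlgebra 𝒜] (f : 𝒜 →+*ᵍ 𝒜)
    (hf : HomogeneousIdeal.irrelevant 𝒜 ≤ (HomogeneousIdeal.irrelevant 𝒜).map f) {i : ℕ}
    (hi : 0 < i) {s t : A} (hs : s ∈ 𝒜 i) (ht : t ∈ 𝒜 i) (hst : f s = t) :
    ∃ ρ : Away 𝒜 s →+* Away 𝒜 t,
      Proj.awayι 𝒜 t ht hi ≫ Proj.map f hf =
        Spec.map (CommRingCat.ofHom ρ) ≫ Proj.awayι 𝒜 s hs hi ∧
      ∀ n a ha, ρ (Away.mk 𝒜 hs n a ha) = Away.mk 𝒜 ht n (f a) (f.2 ha) := by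
  subst hst
  exact ⟨Away.map f s, Proj.awayι_comp_map f hf hi s hs, fun n a ha => Away.map_mk f s hs n a ha⟩

lemma exists_e3Chart_comp_scale (u : k) (hu : u ^ 3 = 1) :
    ∃ ρ : e3Ring k →ₐ[k] e3Ring k,
      e3Chart k ≫ (scale u hu).left = Spec.map (CommRingCat.ofHom ρ.toRingHom) ≫ e3Chart k ∧
      ρ (e3Coord k 0) = algebraMap k _ u * e3Coord k 0 ∧ ρ (e3Coord k 1) = e3Coord k 1 := by
  have hX2 : scaleHom u hu (Ideal.Quotient.mkₐ k (Ideal.span {cubic k}) (X 2)) =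
      Ideal.Quotient.mkₐ k (Ideal.span {cubic k}) (X 2) := by
    refine (scaleHom_mk u hu _).trans ?_
    simp [scalePoly]
  obtain ⟨ρ, h1, h2⟩ := exists_awayι_comp_map (scaleHom u hu) (irrelevant_le_map _ (by
      rintro d _ ⟨f, hf, rfl⟩
      refine ⟨Ideal.Quotient.mk _ (scalePoly (u ^ 2) f), ⟨_, scalePoly_mem _ hf, rfl⟩, ?_⟩
      rw [scaleHom_mk, ← AlgHom.comp_apply, scalePoly_comp, ← pow_succ', hu, scalePoly_one]
      rfl)) one_pos (mk_X_mem_coordGrading k 2) (mk_X_mem_coordGrading k 2) hX2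
  have h3 : e3Chart k ≫ (scale u hu).left = Spec.map (CommRingCat.ofHom ρ) ≫ e3Chart k := h1
  -- `ρ` is `k`-linear because the scaling is a morphism over `k`.
  have h4 : CommRingCat.ofHom (algebraMap k (e3Ring k)) ≫ CommRingCat.ofHom ρ =
      CommRingCat.ofHom (algebraMap k (e3Ring k)) := by
    apply Spec.map_injective
    rw [Spec.map_comp, ← e3Chart_comp_hom, ← Category.assoc, ← h3, Category.assoc, Over.w]
  refine ⟨⟨ρ, fun c => congr($h4 c)⟩, h3, ?_, ?_⟩
  · refine (h2 _ _ _).trans ?_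
    have := aeval_e3Coord k (scalePoly_mem u (isHomogeneous_X k (0 : Fin 3)))
    refine this.symm.trans ?_
    simp [scalePoly]
  · refine (h2 _ _ _).trans ?_
    have := aeval_e3Coord k (scalePoly_mem u (isHomogeneous_X k (1 : Fin 3)))
    refine this.symm.trans ?_
    simp [scalePoly]

end CurveChart

/-! ### Morphisms to an affine scheme as ring homomorphisms. -/

section ToSpec

/-- The ring homomorphism corresponding to a morphism to an affine scheme. -/
def sectionsHom {T : Scheme.{u}} {R : CommRingCat.{u}} (g : T ⟶ Spec R) : R ⟶ Γ(T, ⊤) :=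
  (Scheme.ΓSpecIso R).inv ≫ g.appTop

variable {T : Scheme.{u}} {R S : CommRingCat.{u}}

lemma sectionsHom_comp_SpecMap (g : T ⟶ Spec R) (f : S ⟶ R) :
    sectionsHom (g ≫ Spec.map f) = f ≫ sectionsHom g := by
  rw [sectionsHom, sectionsHom, Scheme.Hom.comp_appTop, Scheme.ΓSpecIso_inv_naturality_assoc]

lemma toSpecΓ_comp_SpecMap_sectionsHom (g : T ⟶ Spec R) :
    T.toSpecΓ ≫ Spec.map (sectionsHom g) = g := by
  rw [sectionsHom, Spec.map_comp, ← Scheme.toSpecΓ_naturality_assoc, ← SpecMap_ΓSpecIso_hom,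
    ← Spec.map_comp, Iso.inv_hom_id, Spec.map_id, Category.comp_id]

lemma sectionsHom_toSpecΓ_comp_SpecMap (f : R ⟶ Γ(T, ⊤)) :
    sectionsHom (T.toSpecΓ ≫ Spec.map f) = f := by
  rw [sectionsHom_comp_SpecMap, sectionsHom, Scheme.toSpecΓ_appTop, Iso.inv_hom_id,
    Category.comp_id]

lemma sectionsHom_injective : Function.Injective (sectionsHom : (T ⟶ Spec R) → _) := fun g g' h => by
  rw [← toSpecΓ_comp_SpecMap_sectionsHom g, h, toSpecΓ_comp_SpecMap_sectionsHom]

end ToSpec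

/-! ### The affine chart of the product is an open immersion. -/

section PowerChart
variable {k A : Type u} [Field k] [CommRing A] [Algebra k A] {n : ℕ} {x y : Fin n → A}

/-- The projection of the affine chart of `E₃ⁿ` to the affine chart of the `i`-th factor. -/
def IsAffinePower.coordHom (h : IsAffinePower k x y) (i : Fin n) : e3Ring k →ₐ[k] A :=
  (exists_e3Ring_lift (h.rel i)).choose

lemma IsAffinePower.coordHom_zero (h : IsAffinePower k x y) (i : Fin n) :
    h.coordHom i (e3Coord k 0) = x i :=
  (exists_e3Ring_lift (h.rel i)).choose_spec.1

lemma IsAffinePower.coordHom_one (h : IsAffinePower k x y) (i : Fin n) :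
    h.coordHom i (e3Coord k 1) = y i :=
  (exists_e3Ring_lift (h.rel i)).choose_spec.2

lemma IsAffinePower.hom_ext (h : IsAffinePower k x y) {B : Type*} [CommRing B] {f g : A →+* B}
    (hk : ∀ c, f (algebraMap k A c) = g (algebraMap k A c)) (hx : ∀ i, f (x i) = g (x i))
    (hy : ∀ i, f (y i) = g (y i)) : f = g := by
  ext a
  have ha : a ∈ Algebra.adjoin k (Set.range x ∪ Set.range y) := h.adjoin_eq_top ▸ trivial
  induction ha using Algebra.adjoin_induction with
  | mem a ha =>
    rcases ha with ⟨i, rfl⟩ | ⟨i, rfl⟩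
    · exact hx i
    · exact hy i
  | algebraMap c => exact hk c
  | add a b _ _ ha hb => rw [map_add, map_add, ha, hb]
  | mul a b _ _ ha hb => rw [map_mul, map_mul, ha, hb]

/-- The morphism to `E₃` given by the `i`-th coordinates. -/
def IsAffinePower.toE3 (h : IsAffinePower k x y) (i : Fin n) :
    Over.mk (Spec.map (CommRingCat.ofHom (algebraMap k A))) ⟶ E3 k :=
  Over.homMk (Spec.map (CommRingCat.ofHom (h.coordHom i).toRingHom) ≫ e3Chart k) (by
    simp only [Over.mk_hom]
    rw [Category.assoc, e3Chart_comp_hom, ← Spec.map_comp, ← CommRingCat.ofHom_comp]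
    congr 2
    exact (h.coordHom i).comp_algebraMap)

/-- The affine chart of `E₃ⁿ`, as a morphism of `k`-schemes. -/
def IsAffinePower.toE3Pow (h : IsAffinePower k x y) :
    Over.mk (Spec.map (CommRingCat.ofHom (algebraMap k A))) ⟶ E3Pow k n :=
  Pi.lift h.toE3

/-- The affine chart of `E₃ⁿ`. -/
def IsAffinePower.chart (h : IsAffinePower k x y) : Spec (.of A) ⟶ (E3Pow k n).left :=
  h.toE3Pow.left

lemma IsAffinePower.chart_comp_hom (h : IsAffinePower k x y) :
    h.chart ≫ (E3Pow k n).hom = Spec.map (CommRingCat.ofHom (algebraMap k A)) :=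
  Over.w h.toE3Pow

/-- The `i`-th projection of `E₃ⁿ`. -/
def e3Proj (k : Type u) [Field k] {n : ℕ} (i : Fin n) : E3Pow k n ⟶ E3 k :=
  Pi.π (fun _ : Fin n => E3 k) i

lemma IsAffinePower.chart_comp_proj (h : IsAffinePower k x y) (i : Fin n) :
    h.chart ≫ (e3Proj k i).left =
      Spec.map (CommRingCat.ofHom (h.coordHom i).toRingHom) ≫ e3Chart k := by
  have : h.toE3Pow ≫ e3Proj k i = h.toE3 i := Pi.lift_π _ _
  exact congr(($this).left)

lemma IsAffinePower.eq_of_comp_coordHom (h : IsAffinePower k x y) {T : Scheme.{u}}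
    {g g' : T ⟶ Spec (.of A)}
    (hk : g ≫ Spec.map (CommRingCat.ofHom (algebraMap k A)) =
      g' ≫ Spec.map (CommRingCat.ofHom (algebraMap k A)))
    (hi : ∀ i, g ≫ Spec.map (CommRingCat.ofHom (h.coordHom i).toRingHom) =
      g' ≫ Spec.map (CommRingCat.ofHom (h.coordHom i).toRingHom)) : g = g' := by
  apply sectionsHom_injective
  have hk' := congr_arg sectionsHom hk
  have hi' (i) := congr_arg sectionsHom (hi i)
  simp only [sectionsHom_comp_SpecMap] at hk' hi'
  ext1
  refine h.hom_ext (fun c => congr($hk' c)) (fun i => ?_) (fun i => ?_)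
  · rw [← h.coordHom_zero]
    exact congr($(hi' i) (e3Coord k 0))
  · rw [← h.coordHom_one]
    exact congr($(hi' i) (e3Coord k 1))

/-- Each coordinate of a morphism to `Spec A` can be read off from its projection to `E3 k`, since
`e3Chart k` is a monomorphism. -/
instance IsAffinePower.mono_chart (h : IsAffinePower k x y) : Mono h.chart where
  right_cancellation g g' hg := by
    refine h.eq_of_comp_coordHom ?_ fun i => ?_
    · rw [← h.chart_comp_hom, reassoc_of% hg]
    · rw [← cancel_mono (e3Chart k), Category.assoc, Category.assoc, ← h.chart_comp_proj,
        reassoc_of% hg]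

variable (k n) in
/-- The open subset of `E₃ⁿ` where all coordinates lie in the chart `Z ≠ 0`. -/
def affineLocus : (E3Pow k n).left.Opens :=
  ⟨⋂ i, (e3Proj k i).left ⁻¹' (e3Chart k).opensRange, isOpen_iInter_of_finite fun i =>
    (e3Chart k).opensRange.2.preimage (e3Proj k i).left.continuous⟩

lemma IsAffinePower.range_chart_subset (h : IsAffinePower k x y) :
    Set.range h.chart ⊆ affineLocus k n := by
  rintro _ ⟨z, rfl⟩
  refine Set.mem_iInter.mpr fun i => ?_
  have := congr($(h.chart_comp_proj i) z)
  exact ⟨_, this.symm⟩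

/-- On this locus every projection lands in the affine chart, so its coordinates are global sections
solving the equations; the universal property of `A` assembles them into a morphism to `Spec A`. -/
lemma IsAffinePower.exists_affineLocus_hom (h : IsAffinePower k x y) :
    ∃ b : (affineLocus k n).toScheme ⟶ Spec (.of A), b ≫ h.chart = (affineLocus k n).ι := by
  let U := affineLocus k n
  let s : U.toScheme ⟶ Spec (.of k) := U.ι ≫ (E3Pow k n).hom
  have hr (i) : Set.range (U.ι ≫ (e3Proj k i).left) ⊆ Set.range (e3Chart k) := by
    rintro _ ⟨z, rfl⟩
    exact Set.mem_iInter.mp z.2 i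
  let ρ (i) : U.toScheme ⟶ Spec (.of (e3Ring k)) :=
    IsOpenImmersion.lift (e3Chart k) (U.ι ≫ (e3Proj k i).left) (hr i)
  have hρ (i) : ρ i ≫ e3Chart k = U.ι ≫ (e3Proj k i).left := IsOpenImmersion.lift_fac _ _ _
  have hρk (i) : ρ i ≫ Spec.map (CommRingCat.ofHom (algebraMap k (e3Ring k))) = s := by
    rw [← e3Chart_comp_hom, reassoc_of% hρ i, Over.w]
  let : Algebra k Γ(U.toScheme, ⊤) := (sectionsHom s).hom.toAlgebra
  let r (i) : e3Ring k →ₐ[k] Γ(U.toScheme, ⊤) :=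
    ⟨(sectionsHom (ρ i)).hom, fun c => by
      have := congr_arg sectionsHom (hρk i)
      rw [sectionsHom_comp_SpecMap] at this
      exact congr($this c)⟩
  obtain ⟨f, hfx, hfy⟩ := h.exists_lift (fun i => r i (e3Coord k 0)) (fun i => r i (e3Coord k 1))
    (fun i => by rw [← map_pow, ← map_add, e3Coord_rel, map_pow])
  let b : U.toScheme ⟶ Spec (.of A) := U.toScheme.toSpecΓ ≫ Spec.map (CommRingCat.ofHom f.toRingHom)
  have hb : sectionsHom b = CommRingCat.ofHom f.toRingHom := sectionsHom_toSpecΓ_comp_SpecMap _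
  have hbk : b ≫ Spec.map (CommRingCat.ofHom (algebraMap k A)) = s := by
    apply sectionsHom_injective
    rw [sectionsHom_comp_SpecMap, hb]
    ext c
    exact f.commutes c
  have hbi (i) : b ≫ Spec.map (CommRingCat.ofHom (h.coordHom i).toRingHom) = ρ i := by
    apply sectionsHom_injective
    rw [sectionsHom_comp_SpecMap, hb]
    ext1
    have : f.comp (h.coordHom i) = r i :=
      e3Ring_hom_ext (by simp [h.coordHom_zero, hfx]) (by simp [h.coordHom_one, hfy])
    exact congr_arg AlgHom.toRingHom this
  refine ⟨b, ?_⟩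
  let b' : Over.mk s ⟶ Over.mk (Spec.map (CommRingCat.ofHom (algebraMap k A))) := Over.homMk b hbk
  let ι' : Over.mk s ⟶ E3Pow k n := Over.homMk U.ι rfl
  have : b' ≫ h.toE3Pow = ι' := by
    refine Pi.hom_ext _ _ fun i => ?_
    ext1
    change (b ≫ h.chart) ≫ (e3Proj k i).left = U.ι ≫ (e3Proj k i).left
    rw [Category.assoc, h.chart_comp_proj, reassoc_of% hbi i, hρ]
  exact congr(($this).left)

/-- The monomorphism `h.chart` factors through the open locus and has an inverse there by the
preceding lemma. -/
lemma IsAffinePower.isOpenImmersion_chart (h : IsAffinePower k x y) : IsOpenImmersion h.chart := by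
  obtain ⟨b, hb⟩ := h.exists_affineLocus_hom
  have hr : Set.range h.chart ⊆ Set.range (affineLocus k n).ι := by
    simpa using h.range_chart_subset
  let a := IsOpenImmersion.lift (affineLocus k n).ι h.chart hr
  have ha : a ≫ (affineLocus k n).ι = h.chart := IsOpenImmersion.lift_fac _ _ _
  have h1 : b ≫ a = 𝟙 _ := by
    rw [← cancel_mono (affineLocus k n).ι, Category.assoc, ha, hb, Category.id_comp]
  have h2 : a ≫ b = 𝟙 _ := by
    rw [← cancel_mono h.chart, Category.assoc, hb, ha, Category.id_comp]
  have : IsIso a := ⟨b, h2, h1⟩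
  rw [← ha]
  infer_instance

end PowerChart

/-! ### The group acting on the affine chart. -/

section Action
variable {k A : Type u} [Field k] [CommRing A] [Algebra k A] {n : ℕ} {x y : Fin n → A}

/-- The automorphism `e` of `E₃` acts on the affine chart by `x ↦ ux`, `y ↦ y`. -/
def ActsOnChart (e : Aut (E3 k)) (u : k) : Prop :=
  ∃ ρ : e3Ring k →ₐ[k] e3Ring k,
    e3Chart k ≫ e.hom.left = Spec.map (CommRingCat.ofHom ρ.toRingHom) ≫ e3Chart k ∧
    ρ (e3Coord k 0) = algebraMap k _ u * e3Coord k 0 ∧ ρ (e3Coord k 1) = e3Coord k 1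

lemma actsOnChart_tau (ζ : k) (hζ : ζ ^ 3 = 1) : ActsOnChart (tau ζ hζ) ζ :=
  exists_e3Chart_comp_scale ζ hζ

lemma actsOnChart_one : ActsOnChart (1 : Aut (E3 k)) 1 := by
  refine ⟨AlgHom.id k _, ?_, by simp, rfl⟩
  have : CommRingCat.ofHom (AlgHom.id k (e3Ring k)).toRingHom = 𝟙 _ := rfl
  rw [this, Spec.map_id, Category.id_comp]
  exact Category.comp_id _

lemma ActsOnChart.mul {e e' : Aut (E3 k)} {u u' : k} (h : ActsOnChart e u)
    (h' : ActsOnChart e' u') : ActsOnChart (e * e') (u * u') := by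
  obtain ⟨ρ, h1, h2, h3⟩ := h
  obtain ⟨ρ', h1', h2', h3'⟩ := h'
  -- A product in `Aut` applies its right factor first, and `Spec` reverses the order once more.
  refine ⟨ρ'.comp ρ, ?_, ?_, ?_⟩
  · change e3Chart k ≫ e'.hom.left ≫ e.hom.left = _
    rw [reassoc_of% h1', h1, ← Spec.map_comp_assoc]
    rfl
  · rw [AlgHom.comp_apply, h2, map_mul, h2', AlgHom.commutes, map_mul, mul_assoc]
  · rw [AlgHom.comp_apply, h3, h3']

lemma IsAffinePower.algHom_ext (h : IsAffinePower k x y) {B : Type*} [CommRing B] [Algebra k B]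
    {f g : A →ₐ[k] B} (hx : ∀ i, f (x i) = g (x i)) (hy : ∀ i, f (y i) = g (y i)) : f = g :=
  AlgHom.coe_ringHom_injective (h.hom_ext (by simp) hx hy)

/-- Both the map and its inverse come from the universal property, the inverse with multipliers `u i
^ 2`. -/
lemma IsAffinePower.exists_diag (h : IsAffinePower k x y) {u : Fin n → k} (hu : ∀ i, u i ^ 3 = 1) :
    ∃ σ : A ≃ₐ[k] A, (∀ i, σ (x i) = algebraMap k A (u i) * x i) ∧ ∀ i, σ (y i) = y i := by
  have key (v : Fin n → k) (hv : ∀ i, v i ^ 3 = 1) : ∃ σ : A →ₐ[k] A,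
      (∀ i, σ (x i) = algebraMap k A (v i) * x i) ∧ ∀ i, σ (y i) = y i :=
    h.exists_lift _ _ fun i => by rw [mul_pow, ← map_pow, hv, map_one, one_mul, h.rel]
  obtain ⟨σ, h1, h2⟩ := key u hu
  obtain ⟨τ, h3, h4⟩ := key (fun i => u i ^ 2) fun i => by
    rw [← pow_mul, mul_comm, pow_mul, hu, one_pow]
  refine ⟨AlgEquiv.ofAlgHom σ τ (h.algHom_ext (fun i => ?_) fun i => ?_)
    (h.algHom_ext (fun i => ?_) fun i => ?_), h1, h2⟩
  · simp only [AlgHom.comp_apply, h3, map_mul, AlgHom.commutes, h1, AlgHom.id_apply]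
    rw [← mul_assoc, ← map_mul, ← pow_succ, hu, map_one, one_mul]
  · simp [h2, h4]
  · simp only [AlgHom.comp_apply, h3, map_mul, AlgHom.commutes, h1, AlgHom.id_apply]
    rw [← mul_assoc, ← map_mul, ← pow_succ', hu, map_one, one_mul]
  · simp [h2, h4]

lemma IsAffinePower.chart_comp_powAut (h : IsAffinePower k x y) {u : Fin n → k}
    {g : Fin n → Aut (E3 k)} (hg : ∀ i, ActsOnChart (g i) (u i)) {σ : A ≃ₐ[k] A}
    (hσx : ∀ i, σ (x i) = algebraMap k A (u i) * x i) (hσy : ∀ i, σ (y i) = y i) :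
    h.chart ≫ (powAut g).hom.left =
      Spec.map (CommRingCat.ofHom (σ : A →ₐ[k] A).toRingHom) ≫ h.chart := by
  let σ' : Over.mk (Spec.map (CommRingCat.ofHom (algebraMap k A))) ⟶
      Over.mk (Spec.map (CommRingCat.ofHom (algebraMap k A))) :=
    Over.homMk (Spec.map (CommRingCat.ofHom (σ : A →ₐ[k] A).toRingHom)) (by
      simp only [Over.mk_hom]
      rw [← Spec.map_comp, ← CommRingCat.ofHom_comp]
      congr 2
      exact (σ : A →ₐ[k] A).comp_algebraMap)
  have : h.toE3Pow ≫ (powAut g).hom = σ' ≫ h.toE3Pow := by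
    refine Pi.hom_ext _ _ fun i => ?_
    have h1 : (powAut g).hom ≫ e3Proj k i = e3Proj k i ≫ (g i).hom := by
      change Limits.Pi.map (fun i => (g i).hom) ≫ Pi.π (fun _ : Fin n => E3 k) i = _
      rw [Pi.map_π]
      rfl
    change (_ ≫ _) ≫ e3Proj k i = (_ ≫ _) ≫ e3Proj k i
    rw [Category.assoc, h1]
    ext1
    obtain ⟨ρ, hρ, hρ0, hρ1⟩ := hg i
    change h.chart ≫ (e3Proj k i).left ≫ (g i).hom.left =
      (Spec.map (CommRingCat.ofHom (σ : A →ₐ[k] A).toRingHom) ≫ h.chart) ≫ (e3Proj k i).left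
    rw [← Category.assoc, h.chart_comp_proj, Category.assoc, hρ, Category.assoc, h.chart_comp_proj,
      ← Spec.map_comp_assoc, ← Spec.map_comp_assoc, ← CommRingCat.ofHom_comp,
      ← CommRingCat.ofHom_comp]
    congr 3
    have : (h.coordHom i).comp ρ = (σ : A →ₐ[k] A).comp (h.coordHom i) := by
      refine e3Ring_hom_ext ?_ ?_
      · simp [hρ0, h.coordHom_zero, hσx]
      · simp [hρ1, h.coordHom_one, hσy]
    exact congr_arg AlgHom.toRingHom this
  exact congr(($this).left)

/-- The multipliers of the generator of `groupG ζ hζ n 2` with `τ` in position `j`. -/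
def generatorWeight (ζ : k) (j l m : Fin n) : k := if m = j then ζ else if m = l then ζ ^ 2 else 1

lemma generatorWeight_pow_three {ζ : k} (hζ : ζ ^ 3 = 1) (j l m : Fin n) :
    generatorWeight ζ j l m ^ 3 = 1 := by
  unfold generatorWeight
  split_ifs
  · exact hζ
  · rw [← pow_mul, mul_comm, pow_mul, hζ, one_pow]
  · exact one_pow _

/-- The only nontrivial multipliers are `ζ` and `ζ ^ 2`; this is why `∏ x i` is invariant. -/
lemma prod_generatorWeight {ζ : k} (hζ : ζ ^ 3 = 1) {j l : Fin n} (hjl : j ≠ l) :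
    ∏ m, generatorWeight ζ j l m = 1 := by
  have h1 (m) : generatorWeight ζ j l m = (if m = j then ζ else 1) * if m = l then ζ ^ 2 else 1 := by
    unfold generatorWeight
    by_cases h1 : m = j
    · subst h1; simp [hjl]
    · simp [h1]
  simp_rw [h1, Finset.prod_mul_distrib]
  simp [← pow_succ', hζ]

lemma actsOnChart_generator (ζ : k) (hζ : ζ ^ 3 = 1) (j l m : Fin n) :
    ActsOnChart (if m = j then tau ζ hζ else if m = l then tau ζ hζ ^ 2 else 1)
      (generatorWeight ζ j l m) := by
  unfold generatorWeight
  split_ifs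
  · exact actsOnChart_tau ζ hζ
  · rw [pow_two, pow_two]
    exact (actsOnChart_tau ζ hζ).mul (actsOnChart_tau ζ hζ)
  · exact actsOnChart_one

lemma map_prod_generatorWeight {ζ : k} (hζ : ζ ^ 3 = 1)
    {j l : Fin n} (hjl : j ≠ l) (σ : A ≃ₐ[k] A)
    (hσ : ∀ i, σ (x i) = algebraMap k A (generatorWeight ζ j l i) * x i) :
    σ (∏ i, x i) = ∏ i, x i := by
  rw [map_prod]
  simp_rw [hσ]
  rw [Finset.prod_mul_distrib, ← map_prod, prod_generatorWeight hζ hjl, map_one, one_mul]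

/-- Every element of `groupG ζ hζ n 2` preserves the affine chart, the functions `y i` and the
product of the functions `x i`. -/
lemma IsAffinePower.exists_of_mem_groupG (h : IsAffinePower k x y) (ζ : k) (hζ : ζ ^ 3 = 1)
    {g : Aut (E3Pow k n)} (hg : g ∈ groupG ζ hζ n 2) :
    ∃ σ : A ≃ₐ[k] A, h.chart ≫ g.hom.left =
        Spec.map (CommRingCat.ofHom (σ : A →ₐ[k] A).toRingHom) ≫ h.chart ∧
      σ (∏ i, x i) = ∏ i, x i ∧ ∀ i, σ (y i) = y i := by
  induction hg using Subgroup.closure_induction with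
  | mem g hg =>
    obtain ⟨j, l, -, hjl, rfl⟩ := hg
    obtain ⟨σ, h1, h2⟩ := h.exists_diag (generatorWeight_pow_three hζ j l)
    exact ⟨σ, h.chart_comp_powAut (actsOnChart_generator ζ hζ j l) h1 h2,
      map_prod_generatorWeight hζ hjl σ h1, h2⟩
  | one =>
    refine ⟨AlgEquiv.refl, ?_, rfl, fun _ => rfl⟩
    have : CommRingCat.ofHom ((AlgEquiv.refl : A ≃ₐ[k] A) : A →ₐ[k] A).toRingHom = 𝟙 _ := rfl
    rw [this, Spec.map_id, Category.id_comp]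
    exact Category.comp_id _
  | mul g g' _ _ hg hg' =>
    obtain ⟨σ, h1, h2, h3⟩ := hg
    obtain ⟨σ', h1', h2', h3'⟩ := hg'
    refine ⟨σ.trans σ', ?_, by rw [AlgEquiv.trans_apply, h2, h2'], by simp [h3, h3']⟩
    change h.chart ≫ g'.hom.left ≫ g.hom.left = _
    rw [reassoc_of% h1', h1, ← Spec.map_comp_assoc]
    rfl
  | inv g _ hg =>
    obtain ⟨σ, h1, h2, h3⟩ := hg
    refine ⟨σ.symm, ?_, by rw [AlgEquiv.symm_apply_eq, h2],
      fun i => by rw [AlgEquiv.symm_apply_eq, h3]⟩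
    change h.chart ≫ g.inv.left = _
    have h4 : g.hom.left ≫ g.inv.left = 𝟙 _ := congr(($(g.hom_inv_id)).left)
    have h5 : Spec.map (CommRingCat.ofHom (σ.symm : A →ₐ[k] A).toRingHom) ≫
        Spec.map (CommRingCat.ofHom (σ : A →ₐ[k] A).toRingHom) = 𝟙 _ := by
      rw [← Spec.map_comp, ← CommRingCat.ofHom_comp, ← Spec.map_id]
      congr 1
      ext a
      simp
    calc h.chart ≫ g.inv.left = Spec.map (CommRingCat.ofHom (σ.symm : A →ₐ[k] A).toRingHom) ≫
          (Spec.map (CommRingCat.ofHom (σ : A →ₐ[k] A).toRingHom) ≫ h.chart) ≫ g.inv.left := by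
            rw [Category.assoc, reassoc_of% h5]
      _ = _ := by rw [← h1, Category.assoc, h4, Category.comp_id]

end Action

/-! ### Lifting field-valued points to the generic point of a resolution. -/

section Resolution

/-- Evaluating a germ through `φ` is the same as pulling the section back along the corresponding
`K`-point. -/
lemma germ_comp_eq_appLE {X : Scheme.{u}} {ξ : X} {K : CommRingCat.{u}}
    (φ : X.presheaf.stalk ξ ⟶ K) (U : X.Opens) (hU : ξ ∈ U)
    (e : ⊤ ≤ (Spec.map φ ≫ X.fromSpecStalk ξ) ⁻¹ᵁ U) :
    X.presheaf.germ U ξ hU ≫ φ =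
      (Spec.map φ ≫ X.fromSpecStalk ξ).appLE U ⊤ e ≫ (Scheme.ΓSpecIso K).hom := by
  have e' : ⊤ ≤ Spec.map φ ⁻¹ᵁ X.fromSpecStalk ξ ⁻¹ᵁ U := e
  have h1 : (Spec.map φ ≫ X.fromSpecStalk ξ).appLE U ⊤ e =
      (X.fromSpecStalk ξ).app U ≫ (Spec.map φ).appLE _ ⊤ e' := Scheme.Hom.comp_appLE _ _ _ _ _
  have h2 : (Spec (X.presheaf.stalk ξ)).presheaf.map (homOfLE le_top).op ≫
      (Spec.map φ).appLE _ ⊤ e' = (Spec.map φ).appTop :=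
    (Scheme.Hom.map_appLE ..).trans (Spec.map φ).app_eq_appLE.symm
  rw [h1, Scheme.fromSpecStalk_app hU]
  simp only [Category.assoc]
  rw [reassoc_of% h2, Scheme.ΓSpecIso_naturality, Iso.inv_hom_id_assoc]

lemma appLE_comp_appTop {X Y Z : Scheme.{u}} (f : X ⟶ Y) (g : Y ⟶ Z) (U : Z.Opens)
    (e : ⊤ ≤ g ⁻¹ᵁ U) (e' : ⊤ ≤ (f ≫ g) ⁻¹ᵁ U) :
    g.appLE U ⊤ e ≫ f.appTop = (f ≫ g).appLE U ⊤ e' := by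
  have h : f.appTop = f.appLE ⊤ ⊤ le_top := f.app_eq_appLE
  rw [h]
  exact Scheme.Hom.appLE_comp_appLE ..

lemma appLE_comp_appLE_of_comm {X Z : Scheme.{u}} {a : X ⟶ Z} {g : Z ⟶ Z} {s : X ⟶ X}
    (h : a ≫ g = s ≫ a) (U : Z.Opens) (hU : U ≤ g ⁻¹ᵁ U) (e : ⊤ ≤ a ⁻¹ᵁ U) :
    g.appLE U U hU ≫ a.appLE U ⊤ e = a.appLE U ⊤ e ≫ s.appTop := by
  have e' : ⊤ ≤ (s ≫ a) ⁻¹ᵁ U := fun z _ => e (x := s z) trivial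
  rw [appLE_comp_appTop _ _ _ _ e', Scheme.Hom.appLE_comp_appLE]
  simp only [h]

variable {X Y : Scheme.{u}} [IsIntegral X] (π : X ⟶ Y) (V : Y.Opens) [IsIso (π ∣_ V)]

/-- If `π : X ⟶ Y` is an isomorphism over an open set that contains the image of the generic point
of `X`, then the generic point of `X` is determined by its image. -/
lemma mono_fromSpecStalk_comp (hV : π (genericPoint X) ∈ V) :
    Mono (X.fromSpecStalk (genericPoint X) ≫ π) := by
  let j := (π ⁻¹ᵁ V).fromSpecStalkOfMem (genericPoint X) hV
  have h : j ≫ (π ⁻¹ᵁ V).ι = X.fromSpecStalk (genericPoint X) :=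
    Scheme.Opens.fromSpecStalkOfMem_ι _ _ _
  have : Mono (j ≫ (π ⁻¹ᵁ V).ι) := by rw [h]; infer_instance
  have : Mono j := mono_of_mono j (π ⁻¹ᵁ V).ι
  rw [← h, Category.assoc, ← morphismRestrict_ι]
  infer_instance

/-- A field-valued point of `Y` that specializes to the image of the generic point of `X` lifts
to the generic point of `X`, if `π : X ⟶ Y` is an isomorphism over a neighbourhood. -/
lemma exists_functionField_hom (hV : π (genericPoint X) ∈ V) {K : Type u} [Field K]
    (m : Spec (.of K) ⟶ Y) (hm : m (IsLocalRing.closedPoint K) ⤳ π (genericPoint X)) :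
    ∃ φ : X.functionField ⟶ .of K,
      Spec.map φ ≫ X.fromSpecStalk (genericPoint X) ≫ π = m := by
  have hmV : Set.range m ⊆ Set.range V.ι := by
    rintro _ ⟨x, rfl⟩
    rw [Scheme.Opens.range_ι, Subsingleton.elim x (IsLocalRing.closedPoint K)]
    exact hm.mem_open V.2 hV
  let m' := IsOpenImmersion.lift V.ι m hmV
  have hm' : m' ≫ V.ι = m := IsOpenImmersion.lift_fac _ _ _
  -- The point lies in `V`, where `π` can be inverted.
  let γ := m' ≫ inv (π ∣_ V) ≫ (π ⁻¹ᵁ V).ι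
  have hγ : γ ≫ π = m := by
    simp only [γ, Category.assoc]
    rw [← morphismRestrict_ι, IsIso.inv_hom_id_assoc, hm']
  have hs : γ (IsLocalRing.closedPoint K) ⤳ genericPoint X := by
    let ξ : (π ⁻¹ᵁ V).toScheme := ⟨genericPoint X, hV⟩
    have h1 : m' (IsLocalRing.closedPoint K) ⤳ (π ∣_ V) ξ := by
      rw [← V.ι.isOpenEmbedding.isInducing.specializes_iff]
      have e1 : V.ι (m' (IsLocalRing.closedPoint K)) = m (IsLocalRing.closedPoint K) :=
        congr($hm' _)
      have e2 : V.ι ((π ∣_ V) ξ) = π (genericPoint X) :=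
        congr($(morphismRestrict_ι π V) ξ)
      rwa [e1, e2]
    have h2 := (h1.map (inv (π ∣_ V)).continuous).map (π ⁻¹ᵁ V).ι.continuous
    have e3 : inv (π ∣_ V) ((π ∣_ V) ξ) = ξ := congr($(IsIso.hom_inv_id (π ∣_ V)) ξ)
    rw [e3] at h2
    exact h2
  refine ⟨X.presheaf.stalkSpecializes hs ≫ Scheme.stalkClosedPointTo γ, ?_⟩
  rw [Spec.map_comp, Category.assoc, Scheme.SpecMap_stalkSpecializes_fromSpecStalk_assoc,
    Scheme.Spec_stalkClosedPointTo_fromSpecStalk_assoc, hγ]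

end Resolution

/-! ### Stable charts and the function field of a resolved quotient. -/

section Quotient
variable {k A : Type u} [Field k] [CommRing A] {E Y : Over (Spec (.of k))}
  {G : Subgroup (Aut E)} {q : E ⟶ Y} {a : Spec (.of A) ⟶ E.left} [IsOpenImmersion a]

/-- A chart stable under the group is the preimage of an open set of the quotient. -/
lemma IsQuotient.exists_preimage_eq_opensRange (hq : IsQuotient G q)
    (hG : ∀ g ∈ G, ∃ σ : A →+* A,
      a ≫ g.hom.left = Spec.map (CommRingCat.ofHom σ) ≫ a) :
    ∃ W : Y.left.Opens, q.left ⁻¹ᵁ W = a.opensRange := by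
  -- Fibres of `q` are orbits, so the range of a stable chart is saturated; openness of its image
  -- then follows from the quotient topology.
  have h : q.left ⁻¹' (q.left '' Set.range a) = Set.range a := by
    refine subset_antisymm ?_ (Set.subset_preimage_image _ _)
    rintro z ⟨_, ⟨w, rfl⟩, hw⟩
    obtain ⟨g, hg, rfl⟩ := hq.exists_of_eq _ _ hw
    obtain ⟨σ, hσ⟩ := hG g hg
    exact ⟨_, congr($hσ w).symm⟩
  refine ⟨⟨q.left '' Set.range a, ?_⟩, TopologicalSpace.Opens.ext h⟩
  rw [← hq.isQuotientMap.isOpen_preimage, h]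
  exact a.isOpenEmbedding.isOpen_range

/-- Functions on a stable chart that are invariant under the group descend to the quotient. -/
lemma IsQuotient.exists_app_eq_of_invariant (hq : IsQuotient G q)
    (hG : ∀ g ∈ G, ∃ σ : A →+* A,
      a ≫ g.hom.left = Spec.map (CommRingCat.ofHom σ) ≫ a)
    (W : Y.left.Opens) (hW : q.left ⁻¹ᵁ W = a.opensRange) (c : A)
    (hc : ∀ g ∈ G, ∀ σ : A →+* A,
      a ≫ g.hom.left = Spec.map (CommRingCat.ofHom σ) ≫ a → σ c = c)
    (e : ⊤ ≤ (a ≫ q.left) ⁻¹ᵁ W) :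
    ∃ t, (a ≫ q.left).appLE W ⊤ e t = (Scheme.ΓSpecIso (.of A)).inv c := by
  have hW' : ⊤ ≤ a ⁻¹ᵁ q.left ⁻¹ᵁ W := e
  -- The chart identifies sections over the preimage of `W` with `A`, so `c` becomes a section
  -- there, and its invariance can be tested in `A`.
  have hiso : IsIso (a.appLE (q.left ⁻¹ᵁ W) ⊤ hW') := by
    have h1 : IsIso (a.app (q.left ⁻¹ᵁ W)) := a.isIso_app _ hW.le
    have h2 : a ⁻¹ᵁ q.left ⁻¹ᵁ W = ⊤ := top_le_iff.mp hW'
    rw [Scheme.Hom.appLE]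
    have : IsIso (homOfLE hW').op := by
      have : IsIso (homOfLE hW') := ⟨homOfLE le_top, rfl, rfl⟩
      infer_instance
    infer_instance
  have hbij := (ConcreteCategory.isIso_iff_bijective (a.appLE (q.left ⁻¹ᵁ W) ⊤ hW')).mp hiso
  obtain ⟨s, hs⟩ := hbij.2 ((Scheme.ΓSpecIso (.of A)).inv c)
  obtain ⟨t, ht⟩ := hq.exists_app_eq W s fun g hg => by
    obtain ⟨σ, hσ⟩ := hG g hg
    apply hbij.1
    have h1 : g.hom.left.appLE _ _ (le_preimage_preimage (hq.invariant g hg) W) ≫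
        a.appLE (q.left ⁻¹ᵁ W) ⊤ hW' =
        a.appLE (q.left ⁻¹ᵁ W) ⊤ hW' ≫ (Spec.map (CommRingCat.ofHom σ)).appTop :=
      appLE_comp_appLE_of_comm hσ _ _ _
    have h2 := congr($h1 s)
    refine h2.trans ?_
    rw [CommRingCat.comp_apply, hs]
    have h4 := congr($(Scheme.ΓSpecIso_inv_naturality (CommRingCat.ofHom σ)) c)
    refine h4.symm.trans ?_
    rw [CommRingCat.comp_apply]
    exact congr_arg _ (hc g hg σ hσ)
  refine ⟨t, ?_⟩
  rw [Scheme.Hom.comp_appLE, CommRingCat.comp_apply, ht, hs]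

variable [Algebra k A] {X : Over (Spec (.of k))}

/-- The function field of a resolution of a quotient, inside the function field of a stable affine
chart: it is fixed by the group and contains the invariant functions on the chart. -/
lemma IsResolution.exists_functionField_hom {π : X ⟶ Y} (hπ : IsResolution π)
    [IsIntegral X.left] (hq : IsQuotient G q)
    (ha : a ≫ E.hom = Spec.map (CommRingCat.ofHom (algebraMap k A)))
    (hG : ∀ g ∈ G, ∃ σ : A →+* A,
      a ≫ g.hom.left = Spec.map (CommRingCat.ofHom σ) ≫ a)
    {K : Type u} [Field K] [Algebra A K] [IsFractionRing A K] :
    ∃ φ : X.left.functionField ⟶ .of K,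
      CommRingCat.ofHom (toFunctionField X) ≫ φ =
        CommRingCat.ofHom ((algebraMap A K).comp (algebraMap k A)) ∧
      (∀ g ∈ G, ∀ σ : A →+* A, a ≫ g.hom.left = Spec.map (CommRingCat.ofHom σ) ≫ a →
        ∀ σK : K →+* K, (∀ c, σK (algebraMap A K c) = algebraMap A K (σ c)) →
          ∀ z, σK (φ z) = φ z) ∧
      ∀ c : A, (∀ g ∈ G, ∀ σ : A →+* A,
        a ≫ g.hom.left = Spec.map (CommRingCat.ofHom σ) ≫ a → σ c = c) →
          ∃ z, φ z = algebraMap A K c := by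
  obtain ⟨V, hVY, hVX, hV⟩ := hπ.birational
  obtain ⟨W, hW⟩ := hq.exists_preimage_eq_opensRange hG
  let r : Spec (.of K) ⟶ Spec (.of A) := Spec.map (CommRingCat.ofHom (algebraMap A K))
  -- The image in `Y` of the generic point of the chart; it will be lifted to `X`.
  let m : Spec (.of K) ⟶ Y.left := r ≫ a ≫ q.left
  let ξ := genericPoint X.left
  have hξ (U : X.left.Opens) (z : X.left) (hz : z ∈ U) : ξ ∈ U :=
    (genericPoint_specializes z).mem_open U.2 hz
  have hξV : π.left ξ ∈ V := by
    obtain ⟨z, hz⟩ := hVX.nonempty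
    exact hξ (π.left ⁻¹ᵁ V) z hz
  have hr (w : Spec (.of A)) : r (IsLocalRing.closedPoint K) ⤳ w := by
    refine (PrimeSpectrum.le_iff_specializes _ _).mp ?_
    change Ideal.comap (algebraMap A K) (IsLocalRing.maximalIdeal K) ≤ w.asIdeal
    rw [IsLocalRing.maximalIdeal_eq_bot, ← RingHom.ker_eq_comap_bot,
      (RingHom.injective_iff_ker_eq_bot _).mp (IsFractionRing.injective A K)]
    exact bot_le
  have hWmem (w : Y.left) (hw : w ∈ W) : m (IsLocalRing.closedPoint K) ⤳ w := by
    obtain ⟨v, rfl⟩ := hq.isQuotientMap.surjective w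
    have hv : v ∈ q.left ⁻¹ᵁ W := hw
    rw [hW] at hv
    obtain ⟨z, rfl⟩ := hv
    exact ((hr z).map a.continuous).map q.left.continuous
  have hmW : m (IsLocalRing.closedPoint K) ∈ W := by
    have : a (r (IsLocalRing.closedPoint K)) ∈ q.left ⁻¹ᵁ W := by
      rw [hW]
      exact ⟨_, rfl⟩
    exact this
  -- `V` is dense, so it meets `W`, and `π` is surjective over `V`; hence the preimage of `W` is
  -- nonempty and contains the generic point.
  have hξW : π.left ξ ∈ W := by
    obtain ⟨w, hwW, hwV⟩ := hVY.inter_open_nonempty W W.2 ⟨_, hmW⟩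
    have : Function.Surjective (π.left ∣_ V) := (π.left ∣_ V).surjective
    obtain ⟨z, hz⟩ := this ⟨w, hwV⟩
    have hz' : π.left ((π.left ⁻¹ᵁ V).ι z) = w := by
      have := congr($(morphismRestrict_ι π.left V) z)
      refine this.symm.trans ?_
      rw [Scheme.Hom.comp_apply, hz]
      rfl
    refine hξ (π.left ⁻¹ᵁ W) ((π.left ⁻¹ᵁ V).ι z) ?_
    change π.left _ ∈ W
    rwa [hz']
  obtain ⟨φ, hφ⟩ := ZariskiKummer.exists_functionField_hom π.left V hξV m (hWmem _ hξW)
  have hmono := mono_fromSpecStalk_comp π.left V hξV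
  refine ⟨φ, ?_, fun g hg σ hσ σK hσK => ?_, fun c hc => ?_⟩
  · apply Spec.map_injective
    rw [Spec.map_comp, ← fromSpecStalk_genericPoint_comp_hom, ← Over.w π, reassoc_of% hφ,
      CommRingCat.ofHom_comp, Spec.map_comp, ← ha, ← Over.w q]
    simp only [m, r, Category.assoc]
  -- Invariance of `q` makes `m` invariant, and the monomorphism from the generic point of `X` to
  -- `Y` transfers this to `φ`.
  · have hm : Spec.map (CommRingCat.ofHom σK) ≫ m = m := by
      have h1 : Spec.map (CommRingCat.ofHom σK) ≫ r = r ≫ Spec.map (CommRingCat.ofHom σ) := by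
        simp only [r]
        rw [← Spec.map_comp, ← Spec.map_comp, ← CommRingCat.ofHom_comp, ← CommRingCat.ofHom_comp]
        congr 2
        exact RingHom.ext hσK
      simp only [m]
      rw [reassoc_of% h1, ← reassoc_of% hσ]
      have h2 : g.hom.left ≫ q.left = q.left := congr(($(hq.invariant g hg)).left)
      rw [h2]
    have h3 : φ ≫ CommRingCat.ofHom σK = φ := by
      apply Spec.map_injective
      rw [← cancel_mono (X.left.fromSpecStalk (genericPoint X.left) ≫ π.left), hφ, Spec.map_comp,
        Category.assoc, hφ, hm]
    intro z
    exact congr($h3 z)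
  · have e : ⊤ ≤ (a ≫ q.left) ⁻¹ᵁ W := by
      intro w _
      have : a w ∈ q.left ⁻¹ᵁ W := by rw [hW]; exact ⟨w, rfl⟩
      exact this
    obtain ⟨t, ht⟩ := hq.exists_app_eq_of_invariant hG W hW c hc e
    -- The preimage of `c` is the germ of the pullback to `X` of the function `t` on the quotient to
    -- which `c` descends.
    refine ⟨X.left.presheaf.germ (π.left ⁻¹ᵁ W) ξ hξW (π.left.app W t), ?_⟩
    have e1 : (⊤ : (Spec (.of K)).Opens) ≤ m ⁻¹ᵁ W := fun z _ => e (x := r z) trivial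
    have e2 : ⊤ ≤ ((Spec.map φ ≫ X.left.fromSpecStalk ξ) ≫ π.left) ⁻¹ᵁ W := by
      rw [Category.assoc, hφ]
      exact e1
    have h1 := congr($(germ_comp_eq_appLE φ (π.left ⁻¹ᵁ W) hξW e2) (π.left.app W t))
    refine h1.trans ?_
    have h2 : π.left.app W ≫ (Spec.map φ ≫ X.left.fromSpecStalk ξ).appLE (π.left ⁻¹ᵁ W) ⊤ e2 =
        (a ≫ q.left).appLE W ⊤ e ≫ r.appTop := by
      rw [appLE_comp_appTop _ _ _ _ e1]
      refine (Scheme.Hom.comp_appLE ..).symm.trans ?_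
      congr 1
    have h4 := congr($h2 t)
    rw [CommRingCat.comp_apply] at h4 ⊢
    rw [h4, CommRingCat.comp_apply, ht]
    have h5 := congr($(Scheme.ΓSpecIso_inv_naturality (CommRingCat.ofHom (algebraMap A K))) c)
    rw [CommRingCat.comp_apply, CommRingCat.comp_apply] at h5
    rw [← h5]
    exact congr($((Scheme.ΓSpecIso (.of K)).inv_hom_id) _)

end Quotient

/-! ### The function field of the resolution in explicit generators. -/

section FractionField
open IntermediateField
variable {k A : Type u} [Field k] [CommRing A] [Algebra k A] {n : ℕ} {x y : Fin n → A}
  {K : Type u} [Field K] [Algebra A K] [IsFractionRing A K] [Algebra k K] [IsScalarTower k A K]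

lemma IsAffinePower.field_adjoin_eq_top (h : IsAffinePower k x y) :
    adjoin k (Set.range (fun i => algebraMap A K (x i)) ∪ Set.range fun i => algebraMap A K (y i)) =
      ⊤ := by
  have key (a : A) : algebraMap A K a ∈ adjoin k (Set.range (fun i => algebraMap A K (x i)) ∪
      Set.range fun i => algebraMap A K (y i)) := by
    have ha : a ∈ Algebra.adjoin k (Set.range x ∪ Set.range y) := by
      rw [h.adjoin_eq_top]
      trivial
    induction ha using Algebra.adjoin_induction with
    | mem z hz =>
      rcases hz with ⟨i, rfl⟩ | ⟨i, rfl⟩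
      · exact subset_adjoin _ _ (Or.inl ⟨i, rfl⟩)
      · exact subset_adjoin _ _ (Or.inr ⟨i, rfl⟩)
    | algebraMap r =>
      rw [← IsScalarTower.algebraMap_apply]
      exact IntermediateField.algebraMap_mem _ r
    | add z w _ _ hz hw => rw [map_add]; exact add_mem hz hw
    | mul z w _ _ hz hw => rw [map_mul]; exact mul_mem hz hw
  refine eq_top_iff.mpr fun z _ => ?_
  obtain ⟨a, b, -, rfl⟩ := IsFractionRing.div_surjective (A := A) z
  exact div_mem (key a) (key b)

/-- The `x i` form a transcendence basis since each `y i` is quadratic over them; conversely each `x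
i` is cubic over the `y i`, which are equally many. -/
lemma IsAffinePower.isTranscendenceBasis (h : IsAffinePower k x y) :
    IsTranscendenceBasis k fun i => algebraMap A K (y i) := by
  have hrel (i) : algebraMap A K (y i) ^ 2 + algebraMap A K (y i) = algebraMap A K (x i) ^ 3 := by
    simpa using congr(algebraMap A K $(h.rel i))
  have hx : IsTranscendenceBasis k fun i => algebraMap A K (x i) := by
    have hind : AlgebraicIndependent k fun i => algebraMap A K (x i) :=
      h.algebraicIndependent.map' (f := IsScalarTower.toAlgHom k A K) (IsFractionRing.injective A K)
    refine hind.isTranscendenceBasis_iff_isAlgebraic.mpr ⟨fun z => ?_⟩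
    have hz : z ∈ (⊤ : IntermediateField k K) := trivial
    rw [← h.field_adjoin_eq_top (K := K)] at hz
    induction hz using adjoin_induction with
    | mem z hz =>
      rcases hz with ⟨i, rfl⟩ | ⟨i, rfl⟩
      · exact isAlgebraic_algebraMap (⟨_, Algebra.subset_adjoin ⟨i, rfl⟩⟩ :
          Algebra.adjoin k (Set.range fun i => algebraMap A K (x i)))
      · let c : Algebra.adjoin k (Set.range fun i => algebraMap A K (x i)) :=
          ⟨_, Algebra.subset_adjoin ⟨i, rfl⟩⟩
        refine ⟨Polynomial.X ^ 2 + (Polynomial.X - Polynomial.C (c ^ 3)), ?_, ?_⟩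
        · exact (Polynomial.monic_X_pow_add (n := 2) (by
            rw [Polynomial.degree_X_sub_C]; norm_num)).ne_zero
        · simp only [map_add, map_sub, map_pow, Polynomial.aeval_X, Polynomial.aeval_C]
          change _ + (_ - algebraMap A K (x i) ^ 3) = 0
          rw [← hrel i]
          ring
    | algebraMap r =>
      exact isAlgebraic_algebraMap (algebraMap k
        (Algebra.adjoin k (Set.range fun i => algebraMap A K (x i))) r)
    | add z w _ _ hz hw => exact hz.add hw
    | inv z _ hz => exact hz.inv
    | mul z w _ _ hz hw => exact hz.mul hw
  refine isTranscendenceBasis_of_forall_isAlgebraic hx fun i => ?_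
  let c : Algebra.adjoin k (Set.range fun i => algebraMap A K (y i)) :=
    ⟨_, Algebra.subset_adjoin ⟨i, rfl⟩⟩
  refine ⟨Polynomial.X ^ 3 - Polynomial.C (c ^ 2 + c), Polynomial.X_pow_sub_C_ne_zero (by norm_num) _,
    ?_⟩
  simp only [map_sub, map_pow, Polynomial.aeval_X, Polynomial.aeval_C]
  change algebraMap A K (x i) ^ 3 - (algebraMap A K (y i) ^ 2 + algebraMap A K (y i)) = 0
  rw [hrel i, sub_self]

lemma exists_algHom_fractionField (σ : A ≃ₐ[k] A) :
    ∃ σK : K →ₐ[k] K, ∀ a, σK (algebraMap A K a) = algebraMap A K (σ a) := by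
  let g : A →ₐ[k] K := (IsScalarTower.toAlgHom k A K).comp (σ : A →ₐ[k] A)
  have hg : Function.Injective g := (IsFractionRing.injective A K).comp σ.injective
  exact ⟨IsFractionRing.liftAlgHom hg, fun a => (IsFractionRing.liftAlgHom_apply hg _).trans
    (IsFractionRing.lift_algebraMap hg a)⟩

lemma generatorWeight_castSucc_last {l : ℕ} (ζ : k) (j i : Fin l) :
    generatorWeight ζ j.castSucc (Fin.last l) i.castSucc = if i = j then ζ else 1 := by
  simp [generatorWeight]

/-- The function field of a resolution of `E₃ⁿ / G₂` is generated by the functions `y i` and the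
product of the functions `x i`. -/
lemma exists_functionField_hom_range {l : ℕ} {x y : Fin (l + 1) → A} (h : IsAffinePower k x y)
    {ζ : k} (hζ : IsPrimitiveRoot ζ 3) (h3 : (3 : k) ≠ 0) {X Y : Over (Spec (.of k))}
    {q : E3Pow k (l + 1) ⟶ Y} (hq : IsQuotient (groupG ζ hζ.pow_eq_one (l + 1) 2) q)
    {π : X ⟶ Y} (hπ : IsResolution π) [IsIntegral X.left] :
    ∃ φ : X.left.functionField ⟶ .of K, (∀ c, φ (toFunctionField X c) = algebraMap k K c) ∧
      ∀ z : K, z ∈ Set.range φ ↔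
        z ∈ adjoin k (Set.range (fun i => algebraMap A K (y i)) ∪ {∏ i, algebraMap A K (x i)}) := by
  have := h.isOpenImmersion_chart
  have hG (g) (hg : g ∈ groupG ζ hζ.pow_eq_one (l + 1) 2) : ∃ σ : A →+* A,
      h.chart ≫ g.hom.left = Spec.map (CommRingCat.ofHom σ) ≫ h.chart := by
    obtain ⟨σ, hσ, -⟩ := h.exists_of_mem_groupG ζ hζ.pow_eq_one hg
    exact ⟨_, hσ⟩
  -- The chart is a monomorphism, so a ring map inducing `g` on it is unique and equals the one from
  -- `exists_of_mem_groupG`.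
  have hinv (c : A) (hc : ∀ σ : A ≃ₐ[k] A, σ (∏ i, x i) = ∏ i, x i → (∀ i, σ (y i) = y i) →
      σ c = c) (g) (hg : g ∈ groupG ζ hζ.pow_eq_one (l + 1) 2) (σ : A →+* A)
      (hσ : h.chart ≫ g.hom.left = Spec.map (CommRingCat.ofHom σ) ≫ h.chart) : σ c = c := by
    obtain ⟨σ', h1, h2, h3⟩ := h.exists_of_mem_groupG ζ hζ.pow_eq_one hg
    rw [h1, cancel_mono] at hσ
    have h4 := Spec.map_injective hσ
    have h5 : σ' c = σ c := congr($h4 c)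
    rw [← h5, hc σ' h2 h3]
  obtain ⟨φ, hφk, hφσ, hφ⟩ := hπ.exists_functionField_hom hq h.chart_comp_hom hG (K := K)
  have hφk' (c) : φ (toFunctionField X c) = algebraMap k K c := by
    rw [IsScalarTower.algebraMap_apply k A K]
    exact congr($hφk c)
  refine ⟨φ, hφk', fun z => ⟨?_, fun hz => ?_⟩⟩
  · rintro ⟨f, rfl⟩
    have hj (j : Fin l) : ∃ σ : K →ₐ[k] K, (∀ i, σ (algebraMap A K (y i)) = algebraMap A K (y i)) ∧
        (∀ i, σ (algebraMap A K (x i)) = algebraMap k K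
          (generatorWeight ζ j.castSucc (Fin.last l) i) * algebraMap A K (x i)) ∧
        (σ (∏ i, algebraMap A K (x i)) = ∏ i, algebraMap A K (x i)) ∧ σ (φ f) = φ f := by
      obtain ⟨σ, hσx, hσy⟩ :=
        h.exists_diag (generatorWeight_pow_three hζ.pow_eq_one j.castSucc (Fin.last l))
      obtain ⟨σK, hσK⟩ := exists_algHom_fractionField (K := K) σ
      refine ⟨σK, fun i => by rw [hσK, hσy], fun i => ?_, ?_, ?_⟩
      · rw [hσK, hσx, map_mul, ← IsScalarTower.algebraMap_apply]
      · rw [← map_prod, hσK, map_prod_generatorWeight hζ.pow_eq_one (Fin.castSucc_lt_last j).ne σ hσx]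
      · exact hφσ _ (Subgroup.subset_closure ⟨j.castSucc, Fin.last l, rfl,
          (Fin.castSucc_lt_last j).ne, rfl⟩) _
          (h.chart_comp_powAut (actsOnChart_generator ζ hζ.pow_eq_one _ _) hσx hσy)
          (σK : K →+* K) hσK f
    choose σ hσy hσx hσw hσf using hj
    have hx0 (i) : algebraMap A K (x i) ≠ 0 := by
      rw [Ne, IsFractionRing.to_map_eq_zero_iff]
      exact h.algebraicIndependent.ne_zero i
    refine mem_adjoin_of_forall_map_eq hζ h3 (fun i => ?_) hx0 h.field_adjoin_eq_top σ hσy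
      (fun j => ?_) (fun j i hij => ?_) hσw hσf
    · simpa using congr(algebraMap A K $(h.rel i))
    · rw [hσx, generatorWeight_castSucc_last, if_pos rfl]
    · rw [hσx, generatorWeight_castSucc_last, if_neg hij, map_one, one_mul]
  -- Conversely, the range of `φ` is a field containing `k` and the invariant generators.
  · induction hz using adjoin_induction with
    | mem z hz =>
      rcases hz with ⟨i, rfl⟩ | rfl
      · exact hφ _ (hinv _ fun σ _ hσ => hσ i)
      · rw [← map_prod]
        exact hφ _ (hinv _ fun σ hσ _ => hσ)
    | algebraMap r => exact ⟨_, hφk' r⟩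
    | add z w _ _ hz hw =>
      obtain ⟨z, rfl⟩ := hz
      obtain ⟨w, rfl⟩ := hw
      exact ⟨z + w, map_add φ.hom z w⟩
    | inv z _ hz =>
      obtain ⟨z, rfl⟩ := hz
      by_cases h0 : z = 0
      · refine ⟨0, ?_⟩
        have : φ z = 0 := by rw [h0]; exact map_zero φ.hom
        rw [this, inv_zero]
        exact map_zero φ.hom
      · obtain ⟨w, hw⟩ : ∃ w, z * w = 1 := ⟨z⁻¹, mul_inv_cancel₀ h0⟩
        refine ⟨w, eq_inv_of_mul_eq_one_right ?_⟩
        exact (map_mul φ.hom z w).symm.trans ((congr_arg φ.hom hw).trans (map_one φ.hom))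
    | mul z w _ _ hz hw =>
      obtain ⟨z, rfl⟩ := hz
      obtain ⟨w, rfl⟩ := hw
      exact ⟨z * w, map_mul φ.hom z w⟩

end FractionField

/-! ### Assembly of the rational map and the dimension. -/

section Main
open IntermediateField

/-- Transport along an isomorphism of `k(X)` with a subfield of a rational function field. -/
lemma exists_rationalMap_of_equiv {k : Type u} [Field k] {Ω : Type u} [Field Ω] [Algebra k Ω]
    {X : Over (Spec (.of k))} [IsIntegral X.left] [LocallyOfFiniteType X.hom]
    {L₀ L : IntermediateField k Ω} (h : L₀ ≤ L) {d n : ℕ}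
    (hd : RingHomIsPurelyInseparable (inclusion h).toRingHom d) {v : Fin n → Ω}
    (hv : AlgebraicIndependent k v) (hL : L = adjoin k (Set.range v))
    (e : X.left.functionField ≃+* L₀) (he : ∀ c, e (toFunctionField X c) = algebraMap k L₀ c) :
    ∃ f : (projectiveSpace k n).left ⤏ X.left,
      f.compHom X.hom = (projectiveSpace k n).hom.toRationalMap ∧
      f.IsDominant ∧ RationalMapIsPurelyInseparableOfDegree f d := by
  subst hL
  obtain ⟨j, hj, hjk⟩ := exists_projectiveSpace_chart k n
  obtain ⟨e', he'⟩ := exists_fractionRing_equiv_functionField (.of (MvPolynomial (Fin n) k))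
    (projectiveSpace k n) j hjk
  let e₁ : adjoin k (Set.range v) ≃+* (projectiveSpace k n).left.functionField :=
    hv.aevalEquivField.symm.toRingEquiv.trans e'
  have he₁ (c : k) : e₁ (algebraMap k _ c) = toFunctionField (projectiveSpace k n) c := by
    rw [← he']
    exact congr_arg e' (hv.aevalEquivField.symm.commutes c)
  let ψ : X.left.functionField →+* (projectiveSpace k n).left.functionField :=
    (e₁ : adjoin k (Set.range v) →+* _).comp ((inclusion h).toRingHom.comp
      (e : X.left.functionField →+* L₀))
  have hψ : RingHomIsPurelyInseparable ψ d := (hd.equiv_comp e).comp_equiv e₁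
  refine exists_rationalMap_of_functionField (CommRingCat.ofHom ψ) ?_ d hψ
  ext c
  change e₁ (inclusion h (e (toFunctionField X c))) = _
  rw [he, AlgHom.commutes]
  exact he₁ c

lemma varietyDim_eq_of_equiv {k : Type u} [Field k] {L : Type u} [Field L] [Algebra k L]
    {X : Over (Spec (.of k))} [IsIntegral X.left] (e : X.left.functionField ≃+* L)
    (he : ∀ c, e (toFunctionField X c) = algebraMap k L c) :
    varietyDim X = Algebra.trdeg k L := by
  let := (toFunctionField X).toAlgebra
  exact (AlgEquiv.ofRingEquiv (f := e) he).trdeg_eq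

lemma isZariskiVariety_of_isResolution {k : Type u} [Field k] {p : ℕ} [Fact p.Prime] [CharP k p]
    (hp : p % 3 = 2) {ζ : k} (hζ : IsPrimitiveRoot ζ 3) {l : ℕ} {X Y : Over (Spec (.of k))}
    {q : E3Pow k (l + 2) ⟶ Y} (hq : IsQuotient (groupG ζ hζ.pow_eq_one (l + 2) 2) q)
    {π : X ⟶ Y} (hπ : IsResolution π) : IsZariskiVariety p (l + 2) X := by
  have := hπ.isVariety.isIntegral
  have := hπ.isVariety.locallyOfFiniteType
  have h3 : (3 : k) ≠ 0 := by
    intro h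
    have h1 : p ∣ 3 := (CharP.cast_eq_zero_iff k p 3).mp (by exact_mod_cast h)
    have h2 := (Nat.prime_dvd_prime_iff_eq Fact.out Nat.prime_three).mp h1
    omega
  obtain ⟨A, _, _, _, x, y, h⟩ := exists_isAffinePower k (l + 2)
  let K := FractionRing A
  -- An ambient field large enough to contain the `p`-th root to be adjoined.
  let Ω := AlgebraicClosure K
  obtain ⟨φ, hφk, hφ⟩ := exists_functionField_hom_range h (K := K) hζ h3 hq hπ
  let y' (i) : Ω := algebraMap K Ω (algebraMap A K (y i))
  let w : Ω := algebraMap K Ω (∏ i, algebraMap A K (x i))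
  have hy : IsTranscendenceBasis k y' := (h.isTranscendenceBasis (K := K)).algebraMap_comp
  have hw : w ^ 3 = ∏ i, (y' i ^ 2 + y' i) := by
    simp only [w, y', map_prod, ← Finset.prod_pow, ← map_pow, ← map_add, h.rel]
  obtain ⟨L, hL, v, hins, hv, hLv⟩ := exists_rational_purelyInseparable hp hy hw
  let f : X.left.functionField →+* Ω := (algebraMap K Ω).comp φ.hom
  have hfinj : Function.Injective f := f.injective
  have hf (z : Ω) : z ∈ Set.range f ↔ z ∈ adjoin k (Set.range y' ∪ {w}) := by
    have h1 : Set.range y' ∪ {w} = IsScalarTower.toAlgHom k K Ω ''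
        (Set.range (fun i => algebraMap A K (y i)) ∪ {∏ i, algebraMap A K (x i)}) := by
      rw [Set.image_union, ← Set.range_comp, Set.image_singleton]
      rfl
    rw [h1, ← adjoin_map, IntermediateField.mem_map]
    constructor
    · rintro ⟨z, rfl⟩
      exact ⟨φ z, (hφ _).mp ⟨z, rfl⟩, rfl⟩
    · rintro ⟨z, hz, rfl⟩
      obtain ⟨z, rfl⟩ := (hφ _).mpr hz
      exact ⟨z, rfl⟩
  let e : X.left.functionField ≃+* adjoin k (Set.range y' ∪ {w}) :=
    RingEquiv.ofBijective (f.codRestrict _ fun z => (hf _).mp ⟨z, rfl⟩)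
      ⟨fun a b hab => hfinj congr(($hab).1), fun z => by
        obtain ⟨a, ha⟩ := (hf z).mpr z.2
        exact ⟨a, Subtype.ext ha⟩⟩
  have he (c) : e (toFunctionField X c) = algebraMap k _ c :=
    Subtype.ext ((congr_arg (algebraMap K Ω) (hφk c)).trans
      (IsScalarTower.algebraMap_apply k K Ω c).symm)
  refine ⟨hπ.isVariety, inferInstance, ?_, exists_rationalMap_of_equiv hL hins hv hLv e he⟩
  rw [varietyDim_eq_of_equiv e he]
  -- The dimension is read off from the `y i`, a transcendence basis already lying in the image of
  -- `k(X)`.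
  let y₀ (i) : adjoin k (Set.range y' ∪ {w}) := ⟨y' i, subset_adjoin _ _ (Or.inl ⟨i, rfl⟩)⟩
  have hy₀ : IsTranscendenceBasis k y₀ :=
    .of_comp (adjoin k (Set.range y' ∪ {w})).val Subtype.val_injective hy
  simpa using hy₀.lift_cardinalMk_eq_trdeg.symm

end Main

end ZariskiKummer

end

theorem mainTheorem5 {k : Type u} [Field k] (p : ℕ) [Fact p.Prime] [CharP k p]
    (hp : p ≡ 2 [MOD 3]) (ζ : k) (hζ : IsPrimitiveRoot ζ 3) (n : ℕ) (hn : 2 ≤ n)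
    {X Y : Over (Spec (.of k))}
    (q : E3Pow k n ⟶ Y) (hq : IsQuotient (groupG ζ hζ.pow_eq_one n 2) q)
    (π : X ⟶ Y) (hπ : IsResolution π) :
    IsZariskiVariety p n X := by
  -- The conic uses two of the coordinates, which is where `2 ≤ n` enters.
  obtain ⟨l, rfl⟩ := Nat.exists_eq_add_of_le' hn
  exact isZariskiVariety_of_isResolution hp hζ hq hπ
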